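/- Let $D\subset S^2$ be an unoriented link diagram with $c(D)\ge 1$ crossings which is not split (its projection graph is connected) and is reduced (its projection graph has no cut-vertex). Label the quadrants at each crossing $A$ or $B$ so that the overcrossing strand sweeps out the $A$ quadrants when turned anticlockwise. For a state $s$ (a choice of label at each crossing) let $|s|$ be the number of circles obtained by splitting each crossing as labelled, and let $a(s),b(s)$ be the numbers of crossings labelled $A,B$. Let $$\langle D\rangle=\sum_s A^{a(s)-b(s)}(-A^2-A^{-2})^{|s|-1},$$ let $s_A,s_B$ be the states with all labels $A$, respectively all labels $B$, and let $a_{s_A}$, $a_{s_B}$ be the coefficients in $\langle D\rangle$ of the terms of degree $c(D)+2|s_A|-2$, respectively $-(c(D)+2|s_B|-2)$. The circles of $s_A$ carry one $A$-chord for each crossing, running through the crossing between its two $B$-quadrants; similarly the circles of $s_B$ carry $B$-chords, running between the two $A$-quadrants. An edge of the projection graph is non-alternating of type $+$ if it is over at both ends and of type $-$ if it is under at both ends. Let $G$, the non-alternating skeleton, be the embedded graph dual to the non-alternating edges: it has one vertex in each complementary region of the projection graph whose boundary contains a non-alternating edge, and one edge, with the same sign, across each non-alternating edge. For a graph $K$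 let $f(K)=\sum_C(-1)^{|C|}$, summed over all independent sets $C$ of vertices (including $\emptyset$). Then: 1. The $+$ and $-$ edges of $G$ alternate around each vertex of $G$. Hence $G$ can be split apart at every vertex by joining each $+$ edge to the next $-$ edge in the anticlockwise sense, giving disjoint simple closed curves $G_A$, or in the clockwise sense, giving curves $G_B$. 2. The curves $G_A$ are isotopic to those circles of $s_A$ which contain a non-alternating edge. Explicitly, choose a centre in each complementary region of the projection graph (taking the vertices of $G$ as centres where there are any), and draw from each crossing, in each of its quadrants, a radial arc to the centre of the region containing this quadrant. The isotopy can be taken through systems of disjoint curves transverse to all radial arcs, so in the complement of the crossings and centres. The same holds for $G_B$ and $s_B$. 3. Draw an arc across the complementary regions of $G$, with both ends on the same connected component of $G$, wherever there is one meeting $D$ in just one crossing, approached through the $B$-quadrants (that is, for every crossing whose two $B$-quadrants lie in regions which contain vertices of the same component of $G$). Each end of such an arc lies on $G_A$, and the arcs decorate $G_A$ with chords. The crossings whose $A$-chord has both ends on the same circle of $s_A$ are exactly those for which there is such an arc, with both ends on the same curve of $G_A$; the isotopy in 2 carries the $A$-chord to the arc. In particular circles of $s_A$ made of alternating edges only have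 no $A$-chord with both ends on them. The same holds for $G_B$, $s_B$ and $B$-chords, with arcs approaching the crossing through the $A$-quadrants. 4. For a curve $\gamma$ of $G_A$ let $K_\gamma$ be the graph whose vertices are the arcs in 3 with both ends on $\gamma$, two of them joined by an edge when their ends occur alternately round $\gamma$. Then $$a_{s_A}=(-1)^{|s_A|-1}\prod_{\gamma\in G_A}f(K_\gamma),$$ and, in the same way with $G_B$ and its arcs, $$a_{s_B}=(-1)^{|s_B|-1}\prod_{\gamma\in G_B}f(K_\gamma).$$ -/

import Mathlib

open scoped LaurentPolynomial

universe u

/-! ### Link diagrams -/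

/-- The two labels for the quadrants, and for the splittings, of a crossing. -/
inductive Marker : Type
  | A : Marker
  | B : Marker
  deriving DecidableEq

instance : Fintype Marker where
  elems := {Marker.A, Marker.B}
  complete m := by cases m <;> simp

/-- A dart is an end of an edge of the projection graph: `(c, i)` is the `i`-th of the four ends at
the crossing `c`, numbered anticlockwise round `c`. The same pair `(c, i)` also names the quadrant
at `c` which lies between the ends `i` and `i + 1`, that is, on the left hand side when one
leaves `c` along the end `i`. -/
abbrev Dart (X : Type*) : Type _ := X × ZMod 4

/-- The next dart anticlockwise round the crossing. -/
def rot {X : Type*} (d : Dart X) : Dart X := (d.1, d.2 + 1)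

/-- The next dart clockwise round the crossing. -/
def rotInv {X : Type*} (d : Dart X) : Dart X := (d.1, d.2 - 1)

/-- The overcrossing strand consists of the ends `0` and `2`. -/
def IsOver {X : Type*} (d : Dart X) : Prop := d.2 = 0 ∨ d.2 = 2

instance {X : Type*} (d : Dart X) : Decidable (IsOver d) :=
  inferInstanceAs (Decidable (d.2 = 0 ∨ d.2 = 2))

/-- The label of a quadrant: the overcrossing strand sweeps out the `A` quadrants when it is turned
anticlockwise, so these are the quadrants between the ends `0`, `1` and between `2`, `3`. -/
def quadrant {X : Type*} (q : Dart X) : Marker := if IsOver q then Marker.A else Marker.B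

/-- An unoriented link diagram with set of crossings `X`, drawn on a closed oriented surface and
given by its projection graph, as a combinatorial map, with over/under information at the crossings:
`opp` sends each end of an edge to the other end of that edge. -/
structure LinkDiagram (X : Type u) where
  opp : Dart X → Dart X
  opp_opp : ∀ d, opp (opp d) = d
  opp_ne : ∀ d, opp d ≠ d

namespace LinkDiagram

variable {X : Type u} (D : LinkDiagram X)

/-- Walk along the edge from `d` to its other end, and turn left. Following `faceNext`
one goes anticlockwise round the complementary region on the left of `d`. As
quadrants, `d, faceNext d, faceNext (faceNext d), …` are the successive corners of that region. -/
def faceNext (d : Dart X) : Dart X := rotInv (D.opp d)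

/-- The edges of the projection graph. -/
def Edge : Type _ := Quot fun d d' : Dart X => d' = D.opp d

/-- The complementary regions of the projection graph (when it is connected). -/
def Face : Type _ := Quot fun d d' : Dart X => d' = D.faceNext d

/-- The connected components of the projection graph. -/
def Component : Type _ := Quot fun d d' : Dart X => d.1 = d'.1 ∨ d' = D.opp d

/-- The region which lies on the left of the dart `d`, equivalently which contains the quadrant `d`. -/
def face (d : Dart X) : D.Face := Quot.mk _ d

/-- The component which contains the dart `d`. -/
def component (d : Dart X) : D.Component := Quot.mk _ d

/-- The diagram is drawn on the sphere: Euler's formula. -/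
def Planar : Prop :=
  Nat.card X + Nat.card D.Face = Nat.card D.Edge + 2 * Nat.card D.Component

/-- The diagram is not split (and has at least one crossing): its projection graph is connected. -/
def NonSplit : Prop := Nonempty X ∧ ∀ d d' : Dart X, D.component d = D.component d'

/-- Two darts are connected in the projection graph with the point `c` removed. -/
def ConnectedAvoiding (c : X) : Dart X → Dart X → Prop :=
  Relation.EqvGen fun d d' => d' = D.opp d ∨ (d.1 = d'.1 ∧ d.1 ≠ c)

/-- Removing the point `c` disconnects a component of the projection graph. -/
def IsCutVertex (c : X) : Prop :=
  ∃ d d', D.component d = D.component d' ∧ ¬ D.ConnectedAvoiding c d d'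

/-- The diagram has no cut-vertex. -/
def Reduced : Prop := ∀ c, ¬ D.IsCutVertex c

/-! ### States, the bracket polynomial and its extreme coefficients -/

/-- The end to which `d` is joined by the `m`-splitting at its crossing. The `m`-splitting
joins the two `m`-quadrants, and has one strand round each of the other two quadrants. -/
def splitMate (m : Marker) (d : Dart X) : Dart X := if quadrant d = m then rotInv d else rot d

/-- The state circles of the state `s`, as classes of darts. -/
def StateCircle (s : X → Marker) : Type _ :=
  Quot fun d d' : Dart X => d' = D.opp d ∨ d' = splitMate (s d.1) d

/-- The state circle which contains the dart `d`. -/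
def stateCircle (s : X → Marker) (d : Dart X) : D.StateCircle s := Quot.mk _ d

/-- The number `|s|` of state circles. -/
noncomputable def circleCount (s : X → Marker) : ℕ := Nat.card (D.StateCircle s)

/-- The extreme state, in which all crossings have the same label `m`. -/
def extremeState (X : Type*) (m : Marker) : X → Marker := fun _ => m

section Bracket

variable [Fintype X] [DecidableEq X]

/-- The number of crossings with label `m` in the state `s`: these are `a(s)` and `b(s)`. -/
def labelCount (m : Marker) (s : X → Marker) : ℕ := (Finset.univ.filter fun c => s c = m).card

/-- The Kauffman bracket polynomial, with `T n` for the `n`-th power of the variable. -/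
noncomputable def bracket : ℤ[T;T⁻¹] :=
  ∑ s : X → Marker,
    LaurentPolynomial.T ((labelCount Marker.A s : ℤ) - labelCount Marker.B s) *
      (-LaurentPolynomial.T 2 - LaurentPolynomial.T (-2)) ^ (D.circleCount s - 1)

/-- The extreme degrees: `max(s_A) = c(D) + 2|s_A| - 2` and `min(s_B) = -(c(D) + 2|s_B| - 2)`. -/
noncomputable def extremeDegree : Marker → ℤ
  | Marker.A => (Fintype.card X : ℤ) + 2 * D.circleCount (extremeState X Marker.A) - 2
  | Marker.B => -((Fintype.card X : ℤ) + 2 * D.circleCount (extremeState X Marker.B) - 2)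

/-- The extreme coefficients `a_{s_A}` and `a_{s_B}` of the bracket polynomial. -/
noncomputable def extremeCoeff (m : Marker) : ℤ := D.bracket.coeff (D.extremeDegree m)

end Bracket

/-! ### Curves with chords in the sphere

In each complementary region of the projection graph choose a centre, and for each quadrant draw
a *radial arc* from its crossing to the centre of the region that contains the quadrant. The
radial arcs cut the sphere into quadrilaterals, one round each edge of the projection graph.
The four sides of the quadrilateral round the edge `{d, opp d}` are, in cyclic order, the radial
arcs in the quadrants `d`, `rotInv (opp d)`, `opp d` and `rotInv d`. -/

/-- The two sides of the radial arc in the quadrant `q` lie in the quadrilaterals of the edges with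
ends `q` (side `true`) and `rot q` (side `false`). -/
def sideDart (q : Dart X) (b : Bool) : Dart X := if b then q else rot q

/-- A system of disjoint simple closed curves in the sphere, transverse to the radial arcs and
crossing each radial arc at most once, decorated with chords. -/
structure CurveSystem {X : Type u} (D : LinkDiagram X) where
  /-- The points at which the curves cross the radial arcs. -/
  Pt : Type u
  /-- The quadrant whose radial arc is crossed at a point. -/
  arc : Pt → Dart X
  arc_injective : Function.Injective arc
  /-- The segments into which the curves are cut by the radial arcs: `seg (p, b) (p', b')` means
  that a segment starts at `p` on its side `b` and ends at `p'` on its side `b'`. -/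
  seg : Pt × Bool → Pt × Bool → Prop
  seg_symm : ∀ x y, seg x y → seg y x
  seg_irrefl : ∀ x, ¬ seg x x
  /-- The curves are closed and do not branch. -/
  seg_existsUnique : ∀ x, ∃! y, seg x y
  /-- Each segment lies in one quadrilateral. -/
  seg_edge : ∀ x y, seg x y →
    sideDart (arc y.1) y.2 = sideDart (arc x.1) x.2 ∨
      sideDart (arc y.1) y.2 = D.opp (sideDart (arc x.1) x.2)
  /-- No two segments in a quadrilateral cross (each joining a pair of opposite sides). -/
  seg_noncrossing : ∀ p p' r r', seg (p, true) (p', true) → seg (r, false) (r', false) →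
    arc p' = D.opp (arc p) → rot (arc r) = arc p → rot (arc r') = arc p' → False
  /-- The crossings at which there is a chord. The chord at `c` runs along radial arcs at `c`,
  through `c`, between the points at which the curves cross these radial arcs. -/
  chords : Set X

namespace CurveSystem

variable {D} (S : CurveSystem D)

/-- The curves of the system. -/
def Circle : Type _ := Quot fun p p' : S.Pt => ∃ b b', S.seg (p, b) (p', b')

/-- The curve through the point `p`. -/
def circle (p : S.Pt) : S.Circle := Quot.mk _ p

/-- `p` is an end of the chord at `c`. -/
def IsEnd (c : X) (p : S.Pt) : Prop := c ∈ S.chords ∧ (S.arc p).1 = c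

/-- The chords whose ends both lie on the curve `γ`. -/
def chordsOn (γ : S.Circle) : Set X :=
  {c | (∃ p, S.IsEnd c p) ∧ ∀ p, S.IsEnd c p → S.circle p = γ}

/-- The chords with both ends on the same curve. -/
def crossChords : Set X := {c | ∃ γ, c ∈ S.chordsOn γ}

/-- The points `p` and `p'` can be joined along the curves without meeting the ends of the
chord at `c`. -/
def JoinedAvoiding (c : X) : S.Pt → S.Pt → Prop :=
  Relation.EqvGen fun p p' =>
    ¬ S.IsEnd c p ∧ ¬ S.IsEnd c p' ∧ ∃ b b', S.seg (p, b) (p', b')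

/-- For chords with ends on the same curve: the ends of the chords at `c` and `c'` occur alternately,
that is, the ends of the first separate the ends of the second from each other on the curve. -/
def Alternate (c c' : X) : Prop :=
  ∃ p p', S.IsEnd c' p ∧ S.IsEnd c' p' ∧ ¬ S.JoinedAvoiding c p p'

/-- The intersection graph of the chords with both ends on the curve `γ`. -/
def intersectionGraph (γ : S.Circle) : SimpleGraph (S.chordsOn γ) :=
  SimpleGraph.fromRel fun c c' => S.Alternate c c'

/-- Isotopy, through curves which cross the radial arcs transversely (in particular in the complement
of the crossings and of the centres of the regions), of systems of curves. Such an isotopy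
exists exactly when the curves cross the same radial arcs in the same cyclic orders. It
carries any chord through a crossing `c` along radial arcs to the chord through `c` along the
same radial arcs. -/
def Isotopic (S S' : CurveSystem D) : Prop :=
  ∃ e : S.Pt ≃ S'.Pt, (∀ p, S'.arc (e p) = S.arc p) ∧
    ∀ p b p' b', S.seg (p, b) (p', b') ↔ S'.seg (e p, b) (e p', b')

end CurveSystem

/-- The function `f` on graphs: the sum of `(-1)^|C|` over the independent sets `C` of vertices. -/
noncomputable def indepSum {V : Type*} [Fintype V] (K : SimpleGraph V) : ℤ :=
  open Classical in
  ∑ C ∈ (Finset.univ : Finset (Finset V)).filter (fun C : Finset V => K.IsIndepSet (C : Set V)),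
    (-1 : ℤ) ^ C.card

open Classical in
/-- The product, over the curves of the system, of `f` of their intersection graphs. -/
noncomputable def CurveSystem.indepProduct [Fintype X] {D : LinkDiagram X} (S : CurveSystem D) : ℤ :=
  ∏ᶠ γ : S.Circle, indepSum (S.intersectionGraph γ)

/-! ### Elementary facts on darts -/

theorem rot_rotInv {X : Type*} (d : Dart X) : rot (rotInv d) = d := by
  simp [rot, rotInv]

theorem rotInv_rot {X : Type*} (d : Dart X) : rotInv (rot d) = d := by
  simp [rot, rotInv]

theorem isOver_rot {X : Type*} (d : Dart X) : IsOver (rot d) ↔ ¬ IsOver d := by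
  obtain ⟨c, i⟩ := d
  simp only [IsOver, rot]
  revert i
  decide

theorem isOver_rotInv {X : Type*} (d : Dart X) : IsOver (rotInv d) ↔ ¬ IsOver d := by
  have := isOver_rot (rotInv d)
  rw [rot_rotInv] at this
  rw [this, not_not]

theorem quadrant_eq_iff {X : Type*} {d d' : Dart X} :
    quadrant d = quadrant d' ↔ (IsOver d ↔ IsOver d') := by
  by_cases h : IsOver d <;> by_cases h' : IsOver d' <;> simp [quadrant, h, h']

theorem quadrant_ne_iff {X : Type*} (d : Dart X) (m : Marker) :
    quadrant d ≠ m ↔ quadrant (rotInv d) = m := by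
  by_cases h : IsOver d <;> cases m <;> simp [quadrant, isOver_rotInv, h]

theorem opp_injective : Function.Injective D.opp := fun a b h => by
  rw [← D.opp_opp a, h, D.opp_opp]

theorem rot_injective {X : Type*} : Function.Injective (rot : Dart X → Dart X) := fun a b h => by
  rw [← rotInv_rot a, h, rotInv_rot]

theorem rot_faceNext (d : Dart X) : rot (D.faceNext d) = D.opp d := rot_rotInv _

theorem faceNext_injective : Function.Injective D.faceNext := fun a b h => by
  apply D.opp_injective
  rw [← rot_faceNext, h, rot_faceNext]

theorem stateCircle_opp (s : X → Marker) (d : Dart X) :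
    D.stateCircle s (D.opp d) = D.stateCircle s d :=
  (Quot.sound (r := fun d d' : Dart X => d' = D.opp d ∨ d' = splitMate (s d.1) d)
    (Or.inl rfl)).symm

theorem stateCircle_splitMate (s : X → Marker) (d : Dart X) :
    D.stateCircle s (splitMate (s d.1) d) = D.stateCircle s d :=
  (Quot.sound (r := fun d d' : Dart X => d' = D.opp d ∨ d' = splitMate (s d.1) d)
    (Or.inr rfl)).symm

/-! ### The circles of the extreme states -/

/-- Those state circles of the extreme state with label `m` that have the property `P`, with the
`m`-chord at each crossing. In the neighbourhood of each edge a
state circle follows the edge, and at each crossing it goes round a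
quadrant whose label is not `m`, crossing the radial arc there. -/
def stateCurvesWith (m : Marker) (P : D.StateCircle (extremeState X m) → Prop) :
    CurveSystem D where
  Pt := {q : Dart X // quadrant q ≠ m ∧ P (D.stateCircle _ q)}
  arc q := q.1
  arc_injective := Subtype.val_injective
  seg x y := sideDart y.1.1 y.2 = D.opp (sideDart x.1.1 x.2)
  seg_symm x y h := by rw [h, D.opp_opp]
  seg_irrefl x h := D.opp_ne _ h.symm
  seg_existsUnique := by
    have key : ∀ q : Dart X, quadrant q ≠ m →
        D.stateCircle (extremeState X m) (rot q) = D.stateCircle _ q := fun q hq => by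
      simpa [splitMate, extremeState, hq] using D.stateCircle_splitMate (extremeState X m) q
    rintro ⟨⟨q, hq, hP⟩, b⟩
    have hside : D.stateCircle (extremeState X m) (D.opp (sideDart q b)) = D.stateCircle _ q := by
      have h1 : D.stateCircle (extremeState X m) (D.opp (sideDart q b)) =
          D.stateCircle _ (sideDart q b) := D.stateCircle_opp _ _
      rw [h1]
      cases b
      · exact key q hq
      · rfl
    obtain ⟨e, he⟩ : ∃ e, e = D.opp (sideDart q b) := ⟨_, rfl⟩
    rw [← he] at hside
    by_cases h : quadrant e = m
    · have h' : quadrant (rotInv e) ≠ m := by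
        intro h2; exact ((quadrant_ne_iff e m).2 h2) h
      refine ⟨(⟨rotInv e, h', ?_⟩, false), ?_, ?_⟩
      · rw [← key _ h', rot_rotInv, hside]; exact hP
      · simp [sideDart, rot_rotInv, he]
      · rintro ⟨⟨q', hq', hP'⟩, b'⟩ hs
        cases b'
        · have h3 : rot q' = e := by simpa [sideDart, he] using hs
          subst h3
          simp [rotInv_rot]
        · have h3 : q' = e := by simpa [sideDart, he] using hs
          exact absurd h (h3 ▸ hq')
    · refine ⟨(⟨e, h, ?_⟩, true), ?_, ?_⟩
      · rw [hside]; exact hP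
      · simp [sideDart, he]
      · rintro ⟨⟨q', hq', hP'⟩, b'⟩ hs
        cases b'
        · have h3 : rot q' = e := by simpa [sideDart, he] using hs
          rw [← h3, ← ne_eq, quadrant_ne_iff, rotInv_rot] at h
          exact absurd h hq'
        · have h3 : q' = e := by simpa [sideDart, he] using hs
          subst h3
          rfl
  seg_edge x y h := Or.inr h
  seg_noncrossing := by
    rintro ⟨p, hp, _⟩ p' ⟨r, hr, _⟩ r' - - - h -
    dsimp only at h
    subst h
    rw [quadrant_ne_iff, rotInv_rot] at hp
    exact hr hp
  chords := Set.univ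

/-- All circles of the extreme state with label `m`, with all `m`-chords. -/
def stateCurves (m : Marker) : CurveSystem D := D.stateCurvesWith m fun _ => True

/-- An edge (given by one of its ends) is non-alternating if both its ends are over,
or both are under. -/
def NonAlt (d : Dart X) : Prop := IsOver d ↔ IsOver (D.opp d)

/-- The non-alternating over edges, of type `+`. -/
def IsPlus (d : Dart X) : Prop := IsOver d ∧ IsOver (D.opp d)

/-- The non-alternating under edges, of type `-`. -/
def IsMinus (d : Dart X) : Prop := ¬ IsOver d ∧ ¬ IsOver (D.opp d)

/-- The circles of the extreme state with label `m` that contain a non-alternating edge. -/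
def nonAltStateCurves (m : Marker) : CurveSystem D :=
  D.stateCurvesWith m fun γ => ∃ d, D.NonAlt d ∧ D.stateCircle _ d = γ

/-! ### The non-alternating skeleton

The skeleton `G` is the embedded graph dual to the non-alternating edges of the projection graph. Its
vertices are the centres of those regions that have a non-alternating edge in their boundary.
Each end `d` of a non-alternating edge gives the half-edge of `G` from the centre of
`face d` to the middle of the edge; the other half of this edge of `G` is given by `opp d`.
The half-edges of `G` occur round a vertex in the order in which `faceNext` meets them. -/

/-- The centre of the region `F` is a vertex of the skeleton. -/
def IsSkeletonVertex (F : D.Face) : Prop := ∃ d, D.NonAlt d ∧ D.face d = F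

/-- Two vertices are in the same connected component of the skeleton. -/
def SkeletonConnected : D.Face → D.Face → Prop :=
  Relation.EqvGen fun F F' => ∃ d, D.NonAlt d ∧ D.face d = F ∧ D.face (D.opp d) = F'

/-- The radial arc in the quadrant `q` lies in the angle of the skeleton swept out from the half-edge
`a` anticlockwise to the next half-edge. -/
def InAngle (a q : Dart X) : Prop :=
  ∃ n : ℕ, q = D.faceNext^[n + 1] a ∧ ∀ k < n, ¬ D.NonAlt (D.faceNext^[k + 1] a)

/-- The half-edge `b` of the skeleton is the next one after `a`, anticlockwise round their vertex. -/
def SkeletonNext (a b : Dart X) : Prop := D.InAngle a b ∧ D.NonAlt b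

/-- The sign of the edges of `G` that are joined, in the splitting with label `m`,
to the next edge anticlockwise. -/
def IsFirst : Marker → Dart X → Prop
  | Marker.A => D.IsPlus
  | Marker.B => D.IsMinus

/-- The sign of the edges of `G` that are joined, in the splitting with label `m`,
to the next edge clockwise. -/
def IsSecond : Marker → Dart X → Prop
  | Marker.A => D.IsMinus
  | Marker.B => D.IsPlus

theorem isFirst_iff (m : Marker) (a : Dart X) : D.IsFirst m a ↔ D.NonAlt a ∧ quadrant a = m := by
  by_cases h : IsOver a <;> by_cases h' : IsOver (D.opp a) <;> cases m <;>
    simp [IsFirst, IsPlus, IsMinus, NonAlt, quadrant, h, h']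

theorem isFirst_opp {m : Marker} {a : Dart X} (h : D.IsFirst m a) : D.IsFirst m (D.opp a) := by
  cases m <;> exact ⟨h.2, by rw [D.opp_opp]; exact h.1⟩

theorem nonAlt_opp {a : Dart X} (h : D.NonAlt a) : D.NonAlt (D.opp a) := by
  unfold NonAlt at *
  rw [D.opp_opp]
  exact h.symm

theorem inAngle_injective {a a' q : Dart X} (ha : D.NonAlt a) (ha' : D.NonAlt a')
    (h : D.InAngle a q) (h' : D.InAngle a' q) : a = a' := by
  have aux : ∀ a a' : Dart X, D.NonAlt a → ∀ n n' : ℕ, n ≤ n' →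
      D.faceNext^[n + 1] a = D.faceNext^[n' + 1] a' →
      (∀ k < n', ¬ D.NonAlt (D.faceNext^[k + 1] a')) → a = a' := by
    intro a a' ha n n' hle heq hk
    obtain ⟨j, rfl⟩ := Nat.exists_eq_add_of_le hle
    rw [show n + j + 1 = (n + 1) + j by ring, Function.iterate_add_apply D.faceNext (n + 1) j] at heq
    have h1 := (D.faceNext_injective.iterate (n + 1)) heq
    cases j with
    | zero => simpa using h1
    | succ j => exact absurd (h1 ▸ ha) (hk j (by omega))
  obtain ⟨n, rfl, hn⟩ := h
  obtain ⟨n', he, hn'⟩ := h'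
  rcases le_total n n' with hle | hle
  · exact aux a a' ha n n' hle he hn'
  · exact (aux a' a ha' n' n hle he.symm hn).symm

theorem inAngle_faceNext (a : Dart X) : D.InAngle a (D.faceNext a) := ⟨0, rfl, by simp⟩

theorem inAngle_succ {a q : Dart X} (h : D.InAngle a q) (hq : ¬ D.NonAlt q) :
    D.InAngle a (D.faceNext q) := by
  obtain ⟨n, rfl, hn⟩ := h
  refine ⟨n + 1, (Function.iterate_succ_apply' D.faceNext (n + 1) a).symm, fun k hk => ?_⟩
  rcases Nat.lt_succ_iff_lt_or_eq.1 hk with hk | rfl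
  · exact hn k hk
  · exact hq

theorem inAngle_cases {a q : Dart X} (h : D.InAngle a q) :
    q = D.faceNext a ∨ ∃ q', D.InAngle a q' ∧ ¬ D.NonAlt q' ∧ q = D.faceNext q' := by
  obtain ⟨n, rfl, hn⟩ := h
  cases n with
  | zero => exact Or.inl rfl
  | succ n =>
    refine Or.inr ⟨D.faceNext^[n + 1] a, ⟨n, rfl, fun k hk => hn k (by omega)⟩, hn n (by omega), ?_⟩
    exact Function.iterate_succ_apply' D.faceNext (n + 1) a

theorem quadrant_faceNext (m : Marker) (d : Dart X) :
    quadrant (D.faceNext d) ≠ m ↔ quadrant (D.opp d) = m := by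
  rw [quadrant_ne_iff]
  have : IsOver (rotInv (D.faceNext d)) ↔ IsOver (D.opp d) := by
    rw [isOver_rotInv, faceNext, isOver_rotInv, not_not]
  simp only [quadrant, this]

theorem quadrant_of_inAngle {m : Marker} {a q : Dart X} (ha : D.IsFirst m a)
    (h : D.InAngle a q) : quadrant q ≠ m := by
  obtain ⟨n, rfl, hn⟩ := h
  induction n with
  | zero =>
    exact (D.quadrant_faceNext m a).2 ((D.isFirst_iff m _).1 (D.isFirst_opp ha)).2
  | succ n ih =>
    have h1 := ih fun k hk => hn k (by omega)
    have h2 := hn n (by omega)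
    rw [Function.iterate_succ_apply', quadrant_faceNext]
    generalize D.faceNext^[n + 1] a = d at h1 h2
    by_cases h : IsOver d <;> by_cases h' : IsOver (D.opp d) <;> cases m <;>
      simp_all [NonAlt, quadrant]

theorem exists_inAngle [Finite X] {b : Dart X} (hb : D.NonAlt b) :
    ∃ a, D.NonAlt a ∧ D.InAngle a b := by
  classical
  obtain ⟨n, hn, hb'⟩ : ∃ n, 0 < n ∧ D.faceNext^[n] b = b :=
    D.faceNext_injective.mem_periodicPts b
  -- go back from `b` by the least positive number of steps that leads to a half-edge
  have hex : ∃ j, ∃ a, D.NonAlt a ∧ D.faceNext^[j + 1] a = b :=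
    ⟨n - 1, b, hb, by rwa [Nat.sub_add_cancel hn]⟩
  obtain ⟨a, ha, hab⟩ := Nat.find_spec hex
  refine ⟨a, ha, Nat.find hex, hab.symm, fun k hk hk' => ?_⟩
  refine Nat.find_min hex (m := Nat.find hex - (k + 1)) (by omega) ⟨_, hk', ?_⟩
  rw [← Function.iterate_add_apply, show Nat.find hex - (k + 1) + 1 + (k + 1) = Nat.find hex + 1 by
    omega]
  exact hab

theorem exists_first_inAngle [Finite X] {m : Marker} {b : Dart X} (hb : D.NonAlt b)
    (hm : quadrant b ≠ m) : ∃ a, D.IsFirst m a ∧ D.InAngle a b := by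
  obtain ⟨a, ha, hab⟩ := D.exists_inAngle hb
  refine ⟨a, (D.isFirst_iff m a).2 ⟨ha, ?_⟩, hab⟩
  by_contra h
  have h1 : D.IsFirst (quadrant a) a := (D.isFirst_iff _ a).2 ⟨ha, rfl⟩
  have h2 := D.quadrant_of_inAngle h1 hab
  revert h h2 hm
  generalize quadrant a = x
  generalize quadrant b = y
  cases x <;> cases y <;> cases m <;> simp

/-- An arc can be drawn between two points of one component of the skeleton, across
a complementary region of that component, which meets the projection graph just in the crossing `c`,
approached through the two quadrants whose label is not `m`: as the arc stays in the regions
of the projection graph that contain these two quadrants, this means that these regions both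
contain a vertex of the same component of the skeleton. -/
def IsSkeletonArc (m : Marker) (c : X) : Prop :=
  ∀ q q' : Dart X, q.1 = c → q'.1 = c → quadrant q ≠ m → quadrant q' ≠ m →
    D.IsSkeletonVertex (D.face q) ∧ D.SkeletonConnected (D.face q) (D.face q')

/-- The curves `G_m` that result from splitting the skeleton apart at its vertices, decorated
with the arcs through one crossing. In `G_A` each half-edge of sign `+` is joined to
the next half-edge anticlockwise, and in `G_B` to the next half-edge clockwise
(which are of sign `-`). A strand which joins `a` to the next half-edge `b` anticlockwise crosses
the radial arcs in the angle between them: `(a, q)` is the point at which this strand crosses the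
radial arc in the quadrant `q`. -/
def skeletonCurves [Finite X] (m : Marker) : CurveSystem D where
  Pt := {p : Dart X × Dart X // D.IsFirst m p.1 ∧ D.InAngle p.1 p.2}
  arc p := p.1.2
  arc_injective := by
    rintro ⟨⟨a, q⟩, ha, h⟩ ⟨⟨a', q'⟩, ha', h'⟩ (rfl : q = q')
    rw [D.isFirst_iff] at ha ha'
    obtain rfl := D.inAngle_injective ha.1 ha'.1 h h'
    rfl
  seg x y :=
    -- along a strand, from one radial arc to the next
    (x.2 = true ∧ y.2 = false ∧ y.1.1.1 = x.1.1.1 ∧ ¬ D.NonAlt x.1.1.2 ∧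
      y.1.1.2 = D.faceNext x.1.1.2) ∨
    (y.2 = true ∧ x.2 = false ∧ x.1.1.1 = y.1.1.1 ∧ ¬ D.NonAlt y.1.1.2 ∧
      x.1.1.2 = D.faceNext y.1.1.2) ∨
    -- along an edge of the skeleton, from the end of a strand to the end of a strand
    (x.2 = true ∧ y.2 = true ∧ D.NonAlt x.1.1.2 ∧ y.1.1.2 = D.opp x.1.1.2) ∨
    -- along an edge of the skeleton, from the start of a strand to the start of a strand
    (x.2 = false ∧ y.2 = false ∧ x.1.1.2 = D.faceNext x.1.1.1 ∧ y.1.1.2 = D.faceNext y.1.1.1 ∧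
      y.1.1.1 = D.opp x.1.1.1)
  seg_symm := by
    rintro x y (h | h | ⟨h1, h2, h3, h4⟩ | ⟨h1, h2, h3, h4, h5⟩)
    · exact Or.inr (Or.inl h)
    · exact Or.inl h
    · exact Or.inr (Or.inr (Or.inl ⟨h2, h1, h4 ▸ D.nonAlt_opp h3, by rw [h4, D.opp_opp]⟩))
    · exact Or.inr (Or.inr (Or.inr ⟨h2, h1, h4, h3, by rw [h5, D.opp_opp]⟩))
  seg_irrefl := by
    rintro ⟨p, b⟩ (⟨h1, h2, -⟩ | ⟨h1, h2, -⟩ | ⟨-, -, -, h⟩ | ⟨-, -, -, -, h⟩)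
    · exact Bool.noConfusion (h1.symm.trans h2)
    · exact Bool.noConfusion (h1.symm.trans h2)
    · exact D.opp_ne _ h.symm
    · exact D.opp_ne _ h.symm
  seg_existsUnique := by
    have inj : ∀ p p' : {p : Dart X × Dart X // D.IsFirst m p.1 ∧ D.InAngle p.1 p.2},
        p.1.2 = p'.1.2 → p = p' := by
      rintro ⟨⟨a, q⟩, ha, h⟩ ⟨⟨a', q'⟩, ha', h'⟩ (rfl : q = q')
      rw [D.isFirst_iff] at ha ha'
      obtain rfl := D.inAngle_injective ha.1 ha'.1 h h'
      rfl
    rintro ⟨⟨⟨a, q⟩, ha, hq⟩, b⟩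
    have haN := ((D.isFirst_iff m a).1 ha).1
    cases b
    · rcases D.inAngle_cases hq with h | ⟨q', h1, h2, h3⟩
      · dsimp only at h
        subst h
        refine ⟨(⟨(D.opp a, D.faceNext (D.opp a)), D.isFirst_opp ha, D.inAngle_faceNext _⟩, false),
          Or.inr (Or.inr (Or.inr ⟨rfl, rfl, rfl, rfl, rfl⟩)), ?_⟩
        rintro ⟨p, b'⟩ (⟨h, -⟩ | ⟨h1, h2, h3, h4, h5⟩ | ⟨h, -⟩ | ⟨h1, h2, h3, h4, h5⟩)
        · exact Bool.noConfusion h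
        · dsimp only at h5 h4
          exact absurd (D.faceNext_injective h5 ▸ haN) h4
        · exact Bool.noConfusion h
        · dsimp only at h1 h2 h3 h4 h5
          subst h2
          rw [inj p ⟨(D.opp a, D.faceNext (D.opp a)), D.isFirst_opp ha, D.inAngle_faceNext _⟩
            (h4.trans (by rw [h5]))]
      · dsimp only at h1 h3
        refine ⟨(⟨(a, q'), ha, h1⟩, true), Or.inr (Or.inl ⟨rfl, rfl, rfl, h2, h3⟩), ?_⟩
        rintro ⟨p, b'⟩ (⟨h, -⟩ | ⟨g1, g2, g3, g4, g5⟩ | ⟨h, -⟩ | ⟨g1, g2, g3, g4, g5⟩)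
        · exact Bool.noConfusion h
        · dsimp only at g1 g5
          subst g1
          rw [inj p ⟨(a, q'), ha, h1⟩ (D.faceNext_injective (g5.symm.trans h3))]
        · exact Bool.noConfusion h
        · dsimp only at g3
          exact absurd (D.faceNext_injective (h3.symm.trans g3) ▸ haN) h2
    · by_cases hN : D.NonAlt q
      · have hm : quadrant (D.opp q) ≠ m := by
          have h1 := D.quadrant_of_inAngle ha hq
          dsimp only at h1
          rwa [quadrant_eq_iff.2 hN] at h1
        obtain ⟨a', ha', h'⟩ := D.exists_first_inAngle (D.nonAlt_opp hN) hm
        refine ⟨(⟨(a', D.opp q), ha', h'⟩, true), Or.inr (Or.inr (Or.inl ⟨rfl, rfl, hN, rfl⟩)), ?_⟩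
        rintro ⟨p, b'⟩ (⟨h1, h2, h3, h4, h5⟩ | ⟨h1, h2, -⟩ | ⟨h1, h2, h3, h4⟩ | ⟨h, -⟩)
        · exact absurd hN h4
        · exact Bool.noConfusion h2
        · dsimp only at h2 h4
          subst h2
          rw [inj p ⟨(a', D.opp q), ha', h'⟩ h4]
        · exact Bool.noConfusion h
      · refine ⟨(⟨(a, D.faceNext q), ha, D.inAngle_succ hq hN⟩, false),
          Or.inl ⟨rfl, rfl, rfl, hN, rfl⟩, ?_⟩
        rintro ⟨p, b'⟩ (⟨h1, h2, h3, h4, h5⟩ | ⟨h1, h2, -⟩ | ⟨h1, h2, h3, h4⟩ | ⟨h, -⟩)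
        · dsimp only at h2 h5
          subst h2
          rw [inj p ⟨(a, D.faceNext q), ha, D.inAngle_succ hq hN⟩ h5]
        · exact Bool.noConfusion h2
        · exact absurd h3 hN
        · exact Bool.noConfusion h
  seg_edge := by
    rintro ⟨⟨⟨a, q⟩, ha, hq⟩, b⟩ ⟨⟨⟨a', q'⟩, ha', hq'⟩, b'⟩
      (⟨h1, h2, h3, h4, h5⟩ | ⟨h1, h2, h3, h4, h5⟩ | ⟨h1, h2, h3, h4⟩ | ⟨h1, h2, h3, h4, h5⟩) <;>
      dsimp only at * <;> subst h1 h2 <;> right <;> simp only [sideDart, if_true, Bool.false_eq_true,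
        if_false]
    · rw [h5, rot_faceNext]
    · rw [h5, rot_faceNext, D.opp_opp]
    · exact h4
    · rw [h3, h4, rot_faceNext, rot_faceNext, h5]
  seg_noncrossing := by
    rintro ⟨⟨a, q⟩, ha, hq⟩ p' ⟨⟨a', q'⟩, ha', hq'⟩ r' - h - h' -
    dsimp only at h'
    subst h'
    have h1 := D.quadrant_of_inAngle ha hq
    have h2 := D.quadrant_of_inAngle ha' hq'
    dsimp only at h1 h2
    rw [quadrant_ne_iff, rotInv_rot] at h1
    exact h2 h1
  chords := {c | D.IsSkeletonArc m c}

end LinkDiagram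

/-! A connected planar diagram has a checkerboard colouring. Orient each edge with the coloured
region on its left. Round a crossing outgoing and incoming ends then alternate, so both splittings
respect the orientation, and the circles of any state are the orbits of a permutation of the
outgoing ends (`Checkerboard.perm`). Changing the label at a crossing multiplies this permutation by
the transposition of the two outgoing ends there (`perm_flip`), so it changes the number of circles
by exactly one.

Let a state differ from the extreme state at the crossings of a set $T$. Each change moves the
exponent $a(s)-b(s)$ by two away from the extreme, and this can be made up only by gaining a circle.
The state therefore reaches the extreme degree just when it has $|T|$ more circles than the extreme
state (`extremeCoeff_eq_sum`). By induction on $T$ this means that every chord in $T$ has both ends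
on one circle and no two chords in $T$ are linked (`orbitCount_union_eq_iff`). The coefficient is
thus a signed count of sets of pairwise unlinked self-chords. Chords on different circles are never
linked, so the count factors over the circles (`sum_eq_indepProduct`).

It remains to find the self-chords on the skeleton. An alternating edge keeps a circle of the
extreme state in the same region, and a non-alternating edge takes it across to the neighbouring
region, along an edge of the skeleton. Hence the circles with a non-alternating edge cross the
radial arcs exactly as the split skeleton does (`exists_first_iff`, `skeletonCurves_isotopic`). A
circle without such an edge runs round a single region. A self-chord on it would put two opposite
quadrants of a crossing into one region. Modulo 2 homology of the sphere excludes this when the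
crossing is not a cut-vertex (`face_ne_of_reduced`). -/

/-! ### Multiplying a permutation by a transposition -/

namespace Equiv.Perm

variable {α : Type*}

/-- The number of orbits of a permutation, fixed points included. -/
noncomputable def orbitCount (σ : Perm α) : ℕ := Nat.card (Quotient (SameCycle.setoid σ))

theorem SameCycle.of_step {σ τ : Perm α} (h : ∀ z, σ.SameCycle z (τ z)) {a b : α}
    (hab : τ.SameCycle a b) : σ.SameCycle a b := by
  obtain ⟨i, rfl⟩ := hab
  induction i with
  | zero => exact SameCycle.refl _ _
  | succ i ih =>
    rw [add_comm, zpow_add, mul_apply, zpow_one]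
    exact ih.trans (h _)
  | pred i ih =>
    refine ih.trans ?_
    have h1 := h ((τ ^ (-(i : ℤ) - 1)) a)
    rw [← mul_apply, ← zpow_one_add, add_sub_cancel] at h1
    exact h1.symm

theorem sameCycle_apply_self (σ : Perm α) (z : α) : σ.SameCycle z (σ z) := ⟨1, by simp⟩

variable [DecidableEq α]

theorem sameCycle_of_swap_mul {σ : Perm α} {x y a b : α} (h : σ.SameCycle x y)
    (hab : (swap x y * σ).SameCycle a b) : σ.SameCycle a b := by
  refine SameCycle.of_step (fun z => ?_) hab
  have hz := σ.sameCycle_apply_self z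
  rw [mul_apply]
  rcases eq_or_ne (σ z) x with hx | hx
  · rw [hx, swap_apply_left]; exact (hx ▸ hz).trans h
  rcases eq_or_ne (σ z) y with hy | hy
  · rw [hy, swap_apply_right]; exact (hy ▸ hz).trans h.symm
  · rwa [swap_apply_of_ne_of_ne hx hy]

theorem swap_mul_swap_mul (σ : Perm α) (x y : α) : swap x y * (swap x y * σ) = σ := by
  rw [← mul_assoc, swap_mul_self, one_mul]

variable [Finite α]

/-- Starting from `x`, the product follows `σ` until the step that would first reach `y`, and there
it returns to `x`. -/
theorem not_sameCycle_swap_mul {σ : Perm α} {x y : α} (h : σ.SameCycle x y) (hne : x ≠ y) :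
    ¬ (swap x y * σ).SameCycle x y := by
  classical
  have hex : ∃ k, (σ ^ k) x = y := h.exists_nat_pow_eq
  set k := Nat.find hex with hk
  have hky : (σ ^ k) x = y := Nat.find_spec hex
  have hmin : ∀ j < k, (σ ^ j) x ≠ y := fun j hj => Nat.find_min hex hj
  have hk0 : 0 < k := Nat.pos_of_ne_zero fun h0 => hne (by rw [h0] at hky; simpa using hky)
  intro hcon
  obtain ⟨n, hn⟩ := hcon.exists_nat_pow_eq
  have key : ∀ n : ℕ, ∃ j < k, ((swap x y * σ) ^ n) x = (σ ^ j) x := by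
    intro n
    induction n with
    | zero => exact ⟨0, hk0, rfl⟩
    | succ n ih =>
      obtain ⟨j, hj, hjn⟩ := ih
      rw [pow_succ', mul_apply, hjn, mul_apply, ← mul_apply σ, ← pow_succ']
      rcases (Nat.succ_le_of_lt hj).eq_or_lt with he | hlt
      · refine ⟨0, hk0, ?_⟩
        rw [show j + 1 = k from he, hky, swap_apply_right]; rfl
      · refine ⟨j + 1, hlt, swap_apply_of_ne_of_ne (fun hx => ?_) (hmin _ hlt)⟩
        -- If `x` recurred after `j + 1 < k` steps, `y` would be reached after `k - (j + 1)` steps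
        -- already.
        refine hmin (k - (j + 1)) (by omega) ?_
        rw [← hx, ← mul_apply, ← pow_add, Nat.sub_add_cancel hlt.le, hky]
  obtain ⟨j, hj, hjn⟩ := key n
  exact hmin j hj (hjn ▸ hn)

/-- The cycle of `x` misses `y`, so the product follows `σ` round it until the step that would
return to `x`, and there it goes to `y`. -/
theorem sameCycle_swap_mul {σ : Perm α} {x y : α} (h : ¬ σ.SameCycle x y) :
    (swap x y * σ).SameCycle x y := by
  classical
  have hex : ∃ k, 0 < k ∧ (σ ^ k) x = x := by
    refine ⟨orderOf σ, orderOf_pos σ, by rw [pow_orderOf_eq_one]; rfl⟩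
  obtain ⟨hk0, hkx⟩ := Nat.find_spec hex
  have hmin : ∀ j < Nat.find hex, 0 < j → (σ ^ j) x ≠ x := fun j hj h0 he =>
    Nat.find_min hex hj ⟨h0, he⟩
  generalize Nat.find hex = k at hk0 hkx hmin
  have key : ∀ j < k, ((swap x y * σ) ^ j) x = (σ ^ j) x := by
    intro j
    induction j with
    | zero => intro; rfl
    | succ j ih =>
      intro hj
      rw [pow_succ', mul_apply, ih (by omega), mul_apply, ← mul_apply σ, ← pow_succ']
      exact swap_apply_of_ne_of_ne (hmin _ hj (by omega))
        fun hy => h ⟨(j + 1 : ℕ), by rw [zpow_natCast]; exact hy⟩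
  obtain ⟨j, rfl⟩ := Nat.exists_eq_succ_of_ne_zero hk0.ne'
  refine ⟨(j + 1 : ℕ), ?_⟩
  rw [zpow_natCast, pow_succ', mul_apply, key j (by omega), mul_apply, ← mul_apply σ, ← pow_succ',
    hkx, swap_apply_left]

/-- Two cycles merge and nothing else happens. For the forward direction, the right-hand side is a
transitive relation (`H`) that contains every step of the product. The converse uses that a second
swap restores `σ`. -/
theorem sameCycle_swap_mul_iff {σ : Perm α} {x y a b : α} (h : ¬ σ.SameCycle x y) :
    (swap x y * σ).SameCycle a b ↔ σ.SameCycle a b ∨ (σ.SameCycle a x ∧ σ.SameCycle b y) ∨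
      (σ.SameCycle a y ∧ σ.SameCycle b x) := by
  have h' := sameCycle_swap_mul h
  have up : ∀ {a b}, σ.SameCycle a b → (swap x y * σ).SameCycle a b := fun hab => by
    refine sameCycle_of_swap_mul h' ?_
    rwa [swap_mul_swap_mul]
  constructor
  · rintro ⟨i, rfl⟩
    suffices H : ∀ (z c : α), (σ.SameCycle a z ∨ (σ.SameCycle a x ∧ σ.SameCycle z y) ∨
        (σ.SameCycle a y ∧ σ.SameCycle z x)) →
        (σ.SameCycle z c ∨ (σ.SameCycle z x ∧ σ.SameCycle c y) ∨
        (σ.SameCycle z y ∧ σ.SameCycle c x)) → (σ.SameCycle a c ∨ (σ.SameCycle a x ∧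
        σ.SameCycle c y) ∨ (σ.SameCycle a y ∧ σ.SameCycle c x)) by
      have step : ∀ z, σ.SameCycle z ((swap x y * σ) z) ∨
          (σ.SameCycle z x ∧ σ.SameCycle ((swap x y * σ) z) y) ∨
          (σ.SameCycle z y ∧ σ.SameCycle ((swap x y * σ) z) x) := by
        intro z
        have hz := σ.sameCycle_apply_self z
        rw [mul_apply]
        rcases eq_or_ne (σ z) x with hx | hx
        · rw [hx, swap_apply_left]; exact Or.inr (Or.inl ⟨hx ▸ hz, SameCycle.refl _ _⟩)
        rcases eq_or_ne (σ z) y with hy | hy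
        · rw [hy, swap_apply_right]; exact Or.inr (Or.inr ⟨hy ▸ hz, SameCycle.refl _ _⟩)
        · rw [swap_apply_of_ne_of_ne hx hy]; exact Or.inl hz
      have hpow : ∃ n : ℕ, ((swap x y * σ) ^ n) a = ((swap x y * σ) ^ i) a :=
        SameCycle.exists_nat_pow_eq ⟨i, rfl⟩
      obtain ⟨n, hn⟩ := hpow
      rw [← hn]
      clear hn i
      induction n with
      | zero => exact Or.inl (SameCycle.refl _ _)
      | succ n ih =>
        rw [pow_succ', mul_apply]
        exact H _ _ ih (step _)
    rintro z c (h1 | ⟨h1, h2⟩ | ⟨h1, h2⟩) (h3 | ⟨h3, h4⟩ | ⟨h3, h4⟩)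
    · exact Or.inl (h1.trans h3)
    · exact Or.inr (Or.inl ⟨h1.trans h3, h4⟩)
    · exact Or.inr (Or.inr ⟨h1.trans h3, h4⟩)
    · exact Or.inr (Or.inl ⟨h1, h3.symm.trans h2⟩)
    · exact absurd (h3.symm.trans h2) h
    · exact Or.inl (h1.trans h4.symm)
    · exact Or.inr (Or.inr ⟨h1, h3.symm.trans h2⟩)
    · exact Or.inl (h1.trans h4.symm)
    · exact absurd (h2.symm.trans h3) h
  · rintro (h1 | ⟨h1, h2⟩ | ⟨h1, h2⟩)
    · exact up h1
    · exact (up h1).trans (h'.trans (up h2).symm)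
    · exact (up h1).trans (h'.symm.trans (up h2).symm)

theorem sameCycle_iff_swap_mul {σ : Perm α} {x y a b : α} (h : σ.SameCycle x y) (hne : x ≠ y) :
    σ.SameCycle a b ↔ (swap x y * σ).SameCycle a b ∨
      ((swap x y * σ).SameCycle a x ∧ (swap x y * σ).SameCycle b y) ∨
      ((swap x y * σ).SameCycle a y ∧ (swap x y * σ).SameCycle b x) := by
  have := sameCycle_swap_mul_iff (a := a) (b := b) (not_sameCycle_swap_mul h hne)
  rwa [swap_mul_swap_mul] at this

/-- Splitting an orbit does not affect the other orbits. -/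
theorem SameCycle.swap_mul_of_not {σ : Perm α} {x y a b : α} (h : σ.SameCycle x y) (hne : x ≠ y)
    (hab : σ.SameCycle a b) (hax : ¬ σ.SameCycle a x) : (swap x y * σ).SameCycle a b := by
  rcases (sameCycle_iff_swap_mul h hne).1 hab with h1 | ⟨h1, -⟩ | ⟨h1, -⟩
  · exact h1
  · exact absurd (sameCycle_of_swap_mul h h1) hax
  · exact absurd ((sameCycle_of_swap_mul h h1).trans h.symm) hax

/-- The orbits of `σ` other than that of `y` correspond to the orbits of the product, since the
orbit of `y` is absorbed into that of `x`. -/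
theorem orbitCount_of_not_sameCycle {σ : Perm α} {x y : α} (h : ¬ σ.SameCycle x y) :
    orbitCount σ = orbitCount (swap x y * σ) + 1 := by
  classical
  have : Fintype (Quotient (SameCycle.setoid σ)) := Fintype.ofFinite _
  let f : {q : Quotient (SameCycle.setoid σ) // q ≠ Quotient.mk _ y} →
      Quotient (SameCycle.setoid (swap x y * σ)) := fun q =>
    Quotient.map' (s₁ := SameCycle.setoid σ) (s₂ := SameCycle.setoid (swap x y * σ)) id
      (fun a b hab => (sameCycle_swap_mul_iff h).2 (Or.inl hab)) q.1
  have hf : Function.Bijective f := by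
    constructor
    · rintro ⟨q, hq⟩ ⟨r, hr⟩ hqr
      induction q using Quotient.inductionOn with | h a => ?_
      induction r using Quotient.inductionOn with | h b => ?_
      have h1 : (swap x y * σ).SameCycle a b := Quotient.exact hqr
      refine Subtype.ext (Quotient.sound ?_)
      rcases (sameCycle_swap_mul_iff h).1 h1 with h2 | ⟨-, h2⟩ | ⟨h2, -⟩
      · exact h2
      · exact absurd (Quotient.sound h2) hr
      · exact absurd (Quotient.sound h2) hq
    · intro q
      induction q using Quotient.inductionOn with | h a => ?_
      by_cases ha : σ.SameCycle a y
      · exact ⟨⟨Quotient.mk _ x, fun h1 => h (Quotient.exact h1)⟩, Quotient.sound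
          ((sameCycle_swap_mul_iff h).2 (Or.inr (Or.inl ⟨SameCycle.refl _ _, ha⟩)))⟩
      · exact ⟨⟨Quotient.mk _ a, fun h1 => ha (Quotient.exact h1)⟩, rfl⟩
  have h1 := Nat.card_congr (Equiv.ofBijective f hf)
  unfold orbitCount
  rw [← h1, Nat.card_eq_fintype_card, Nat.card_eq_fintype_card, Fintype.card_subtype_compl]
  have := Fintype.card_pos_iff.2 ⟨Quotient.mk (SameCycle.setoid σ) y⟩
  rw [Fintype.card_subtype_eq]
  omega

theorem orbitCount_swap_mul {σ : Perm α} {x y : α} (h : σ.SameCycle x y) (hne : x ≠ y) :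
    orbitCount (swap x y * σ) = orbitCount σ + 1 := by
  have := orbitCount_of_not_sameCycle (not_sameCycle_swap_mul h hne)
  rwa [swap_mul_swap_mul] at this

/-- If two unlinked chords each do not separate `a` from `b`, then neither do they together. -/
theorem SameCycle.swap_mul_swap_mul {σ σ' τ : Perm α} {x y x' y' a b : α}
    (hτ : τ = swap x' y' * σ) (hτ' : τ = swap x y * σ') (hne : x ≠ y) (hne' : x' ≠ y')
    (h : σ.SameCycle x' y') (h' : σ'.SameCycle x y) (hxy : ¬ σ.SameCycle x y)
    (hab : σ.SameCycle a b) (hab' : σ'.SameCycle a b) : τ.SameCycle a b := by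
  have h1 := (sameCycle_iff_swap_mul h hne').1 hab
  have h2 := (sameCycle_iff_swap_mul h' hne).1 hab'
  have up : ∀ {u v}, τ.SameCycle u v → σ.SameCycle u v := fun huv => by
    subst hτ; exact sameCycle_of_swap_mul h huv
  rw [← hτ] at h1
  rw [← hτ'] at h2
  -- If `τ` separated `a` from `b`, then `a` would lie with one end of each chord and `b` with the
  -- other two ends. As `σ` joins `x'` to `y'`, it would then join `x` to `y`.
  rcases h1 with h1 | ⟨h1, h3⟩ | ⟨h1, h3⟩
  · exact h1
  all_goals
    rcases h2 with h2 | ⟨h2, h4⟩ | ⟨h2, h4⟩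
    · exact h2
    all_goals
      exfalso
      have g1 := up (h1.symm.trans h2)
      have g2 := up (h3.symm.trans h4)
      first
        | exact hxy (g1.symm.trans (h.trans g2))
        | exact hxy (g1.symm.trans (h.symm.trans g2))
        | exact hxy (g2.symm.trans (h.trans g1))
        | exact hxy (g2.symm.trans (h.symm.trans g1))

/-! ### Surgery along a family of chords. -/

section Family

variable {ι : Type*} [DecidableEq ι] {σ : Finset ι → Perm α} {x y : ι → α}

/-- One surgery either splits an orbit or merges two, so the count goes up or down by one and never
stays. -/
theorem orbitCount_insert_le (hne : ∀ c, x c ≠ y c)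
    (hσ : ∀ T, ∀ c ∉ T, σ (insert c T) = swap (x c) (y c) * σ T) {c : ι} {T : Finset ι}
    (hc : c ∉ T) : orbitCount (σ (insert c T)) ≤ orbitCount (σ T) + 1 ∧
      (orbitCount (σ (insert c T)) = orbitCount (σ T) + 1 ↔ (σ T).SameCycle (x c) (y c)) := by
  rw [hσ T c hc]
  by_cases h : (σ T).SameCycle (x c) (y c)
  · have := orbitCount_swap_mul h (hne c)
    exact ⟨this.le, fun _ => h, fun _ => this⟩
  · have := orbitCount_of_not_sameCycle h
    exact ⟨by omega, fun h1 => absurd h1 (by omega), fun h1 => absurd h1 h⟩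

theorem orbitCount_union_le (hne : ∀ c, x c ≠ y c)
    (hσ : ∀ T, ∀ c ∉ T, σ (insert c T) = swap (x c) (y c) * σ T) (B T : Finset ι)
    (hBT : _root_.Disjoint B T) : orbitCount (σ (B ∪ T)) ≤ orbitCount (σ B) + T.card := by
  induction T using Finset.induction_on with
  | empty => simp
  | insert c T hc ih =>
    rw [Finset.disjoint_insert_right] at hBT
    rw [Finset.union_insert, Finset.card_insert_of_notMem hc]
    have h1 := (orbitCount_insert_le hne hσ (c := c) (T := B ∪ T)
      (by simp [hBT.1, hc])).1
    have := ih hBT.2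
    omega

/-- The number of orbits increases as much as possible just when all chords have both ends on one
orbit, and no two of them are linked. -/
theorem orbitCount_union_eq_iff (hne : ∀ c, x c ≠ y c)
    (hσ : ∀ T, ∀ c ∉ T, σ (insert c T) = swap (x c) (y c) * σ T) (B T : Finset ι)
    (hBT : _root_.Disjoint B T) : orbitCount (σ (B ∪ T)) = orbitCount (σ B) + T.card ↔
      (∀ c ∈ T, (σ B).SameCycle (x c) (y c)) ∧
        ∀ c ∈ T, ∀ d ∈ T, c ≠ d → (σ (insert c B)).SameCycle (x d) (y d) := by
  induction T using Finset.induction_on generalizing B with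
  | empty => simp
  | insert c T hc ih =>
    rw [Finset.disjoint_insert_right] at hBT
    obtain ⟨hcB, hBT⟩ := hBT
    have hdis : _root_.Disjoint (insert c B) T := by
      rw [Finset.disjoint_insert_left]; exact ⟨hc, hBT⟩
    have hle := orbitCount_union_le hne hσ (insert c B) T hdis
    obtain ⟨h1, h2⟩ := orbitCount_insert_le hne hσ (c := c) (T := B) hcB
    -- The maximal increase is attained only if each single surgery gains an orbit.
    have hsplit : orbitCount (σ (B ∪ insert c T)) = orbitCount (σ B) + (insert c T).card ↔
        (σ B).SameCycle (x c) (y c) ∧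
          orbitCount (σ (insert c B ∪ T)) = orbitCount (σ (insert c B)) + T.card := by
      rw [← h2, Finset.card_insert_of_notMem hc, Finset.union_insert, ← Finset.insert_union]
      omega
    rw [hsplit, ih (insert c B) hdis]
    have hTc : ∀ d ∈ T, d ≠ c := fun d hd h => hc (h ▸ hd)
    have hTB : ∀ d ∈ T, d ∉ B := fun d hd h => Finset.disjoint_left.1 hBT h hd
    have e1 := hσ B c hcB
    have e2 : ∀ d ∈ T, σ (insert d B) = swap (x d) (y d) * σ B := fun d hd => hσ B d (hTB d hd)
    have e3 : ∀ d ∈ T, σ (insert d (insert c B)) = swap (x d) (y d) * σ (insert c B) :=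
      fun d hd => hσ _ d (by simp [hTc d hd, hTB d hd])
    have e4 : ∀ d ∈ T, σ (insert d (insert c B)) = swap (x c) (y c) * σ (insert d B) :=
      fun d hd => by
        rw [Finset.insert_comm]
        exact hσ _ c (by simp [(hTc d hd).symm, hcB])
    have down : (σ B).SameCycle (x c) (y c) → ∀ {a b}, (σ (insert c B)).SameCycle a b →
        (σ B).SameCycle a b := fun h a b hab => by
      rw [e1] at hab; exact sameCycle_of_swap_mul h hab
    constructor
    · rintro ⟨hcc, hd, hde⟩
      -- Being unlinked is symmetric: surgery along `c` and then `d` gains two orbits, and the other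
      -- order ends at the same permutation. The surgery along `d` gains at most one, so the one
      -- along `c` after it must gain one too.
      have hdc : ∀ d ∈ T, (σ (insert d B)).SameCycle (x c) (y c) := by
        intro d hdT
        have g1 := (orbitCount_insert_le hne hσ (c := d) (T := B) (hTB d hdT)).1
        have g2 := orbitCount_insert_le hne hσ (c := c) (T := insert d B)
          (by simp [(hTc d hdT).symm, hcB])
        have g3 := (orbitCount_insert_le hne hσ (c := d) (T := insert c B)
          (by simp [hTc d hdT, hTB d hdT])).2.2 (hd d hdT)
        have g4 := h2.2 hcc
        rw [Finset.insert_comm] at g3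
        exact g2.2.1 (by omega)
      refine ⟨?_, ?_⟩
      · intro d hd'
        rcases Finset.mem_insert.1 hd' with rfl | hd'
        · exact hcc
        · exact down hcc (hd d hd')
      · intro d hd' e he' hne'
        rcases Finset.mem_insert.1 hd' with rfl | hdT
        · rcases Finset.mem_insert.1 he' with rfl | heT
          · exact absurd rfl hne'
          · exact hd e heT
        · rcases Finset.mem_insert.1 he' with rfl | heT
          · exact hdc d hdT
          · have g := hde d hdT e heT hne'
            rw [e4 d hdT] at g
            exact sameCycle_of_swap_mul (hdc d hdT) g
    · rintro ⟨hs, hp⟩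
      have hcc := hs c (Finset.mem_insert_self _ _)
      refine ⟨hcc, fun d hd => hp c (Finset.mem_insert_self _ _) d (Finset.mem_insert_of_mem hd)
        (hTc d hd).symm, fun d hd e he hde => ?_⟩
      -- After the surgery along `c`, the chords `d` and `e` must still be unlinked: neither `c` nor
      -- `d` alone separates the ends of `e`, so the two together do not.
      refine SameCycle.swap_mul_swap_mul (e3 d hd) (e4 d hd) (hne c) (hne d)
        (hp c (Finset.mem_insert_self _ _) d (Finset.mem_insert_of_mem hd) (hTc d hd).symm)
        (hp d (Finset.mem_insert_of_mem hd) c (Finset.mem_insert_self _ _) (hTc d hd)) ?_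
        (hp c (Finset.mem_insert_self _ _) e (Finset.mem_insert_of_mem he) (hTc e he).symm)
        (hp d (Finset.mem_insert_of_mem hd) e (Finset.mem_insert_of_mem he) hde)
      rw [e1]
      exact not_sameCycle_swap_mul hcc (hne c)

end Family

/-- Removing one point from an orbit leaves a path. -/
theorem eqvGen_avoiding_of_sameCycle {σ : Perm α} {x a : α} (h : σ.SameCycle x a) (hax : a ≠ x) :
    Relation.EqvGen (fun u v => v = σ u ∧ u ≠ x ∧ v ≠ x ∧ σ.SameCycle x u) (σ x) a := by
  classical
  have hex : ∃ k, (σ ^ k) x = a := h.exists_nat_pow_eq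
  have hka := Nat.find_spec hex
  have hmin : ∀ j < Nat.find hex, (σ ^ j) x ≠ a := fun j hj => Nat.find_min hex hj
  generalize Nat.find hex = k at hka hmin
  have hk0 : k ≠ 0 := by rintro rfl; exact hax hka.symm
  have hx : ∀ j, 1 ≤ j → j ≤ k → (σ ^ j) x ≠ x := by
    intro j hj hjk he
    refine hmin (k - j) (by omega) ?_
    rw [← he, ← mul_apply, ← pow_add, Nat.sub_add_cancel hjk, hka]
  have key : ∀ j, j + 1 ≤ k → Relation.EqvGen
      (fun u v => v = σ u ∧ u ≠ x ∧ v ≠ x ∧ σ.SameCycle x u) (σ x) ((σ ^ (j + 1)) x) := by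
    intro j
    induction j with
    | zero => intro; rw [zero_add, pow_one]; exact Relation.EqvGen.refl _
    | succ j ih =>
      intro hj
      refine (ih (by omega)).trans _ _ _ (Relation.EqvGen.rel _ _ ⟨?_, hx _ (by omega) (by omega),
        hx _ (by omega) (by omega), ⟨(j + 1 : ℕ), by rw [zpow_natCast]⟩⟩)
      rw [pow_succ' σ (j + 1), mul_apply]
  have := key (k - 1) (by omega)
  rwa [Nat.sub_add_cancel (by omega), hka] at this

/-- The points `a` and `b` can be joined along the orbits without meeting the ends of a chord just
when they are in the same orbit after surgery along the chord. -/
theorem eqvGen_avoiding_iff {σ : Perm α} {x y a b : α} (h : σ.SameCycle x y) (hne : x ≠ y)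
    (hax : a ≠ x) (hay : a ≠ y) (hbx : b ≠ x) (hby : b ≠ y) :
    Relation.EqvGen (fun u v => v = σ u ∧ (u ≠ x ∧ u ≠ y) ∧ v ≠ x ∧ v ≠ y) a b ↔
      (swap x y * σ).SameCycle a b := by
  have hxy := not_sameCycle_swap_mul h hne
  constructor
  · intro hab
    clear hax hay hbx hby
    induction hab with
    | rel u v huv =>
      obtain ⟨rfl, -, h1, h2⟩ := huv
      have := (swap x y * σ).sameCycle_apply_self u
      rwa [mul_apply, swap_apply_of_ne_of_ne h1 h2] at this
    | refl u => exact SameCycle.refl _ _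
    | symm u v _ ih => exact ih.symm
    | trans u v w _ _ ih1 ih2 => exact ih1.trans ih2
  · set τ := swap x y * σ with hτ
    have step : ∀ u, τ u ≠ x → τ u ≠ y → τ u = σ u := by
      intro u h1 h2
      rcases eq_or_ne (σ u) x with h3 | h3
      · exact absurd (by rw [hτ, mul_apply, h3, swap_apply_left]) h2
      rcases eq_or_ne (σ u) y with h4 | h4
      · exact absurd (by rw [hτ, mul_apply, h4, swap_apply_right]) h1
      · rw [hτ, mul_apply, swap_apply_of_ne_of_ne h3 h4]
    intro hab
    -- Surgery puts `x` and `y` into different cycles of `τ`. A cycle through one of them becomes,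
    -- without that point, a path on which `τ` agrees with `σ`. A cycle through neither is left as
    -- it was.
    by_cases hx : τ.SameCycle x a
    · have aux : ∀ c, τ.SameCycle x c → c ≠ x → Relation.EqvGen
          (fun u v => v = σ u ∧ (u ≠ x ∧ u ≠ y) ∧ v ≠ x ∧ v ≠ y) (τ x) c := fun c hc hcx => by
        refine (eqvGen_avoiding_of_sameCycle hc hcx).mono ?_
        rintro u v ⟨rfl, h1, h2, h3⟩
        have hvy : τ u ≠ y := fun h4 => hxy (h4 ▸ (sameCycle_apply_right.2 h3))
        exact ⟨step u h2 hvy, ⟨h1, fun h4 => hxy (h4 ▸ h3)⟩, h2, hvy⟩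
      exact ((aux a hx hax).symm _ _).trans _ _ _ (aux b (hx.trans hab) hbx)
    by_cases hy : τ.SameCycle y a
    · have aux : ∀ c, τ.SameCycle y c → c ≠ y → Relation.EqvGen
          (fun u v => v = σ u ∧ (u ≠ x ∧ u ≠ y) ∧ v ≠ x ∧ v ≠ y) (τ y) c := fun c hc hcx => by
        refine (eqvGen_avoiding_of_sameCycle hc hcx).mono ?_
        rintro u v ⟨rfl, h1, h2, h3⟩
        have hvy : τ u ≠ x := fun h4 => hxy (h4 ▸ (sameCycle_apply_right.2 h3)).symm
        exact ⟨step u hvy h2, ⟨fun h4 => hxy (h4 ▸ h3).symm, h1⟩, hvy, h2⟩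
      exact ((aux a hy hay).symm _ _).trans _ _ _ (aux b (hy.trans hab) hby)
    · obtain ⟨n, rfl⟩ := hab.exists_nat_pow_eq
      clear hab hbx hby
      have hn : ∀ n : ℕ, (τ ^ n) a ≠ x ∧ (τ ^ n) a ≠ y := fun n =>
        ⟨fun h1 => hx (h1 ▸ (SameCycle.symm ⟨n, by rw [zpow_natCast]⟩)),
          fun h1 => hy (h1 ▸ (SameCycle.symm ⟨n, by rw [zpow_natCast]⟩))⟩
      induction n with
      | zero => exact Relation.EqvGen.refl _
      | succ n ih =>
        refine ih.trans _ _ _ (Relation.EqvGen.rel _ _ ⟨?_, hn n, hn (n + 1)⟩)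
        have h1 := hn (n + 1)
        rw [pow_succ', mul_apply] at h1 ⊢
        exact step _ h1.1 h1.2

end Equiv.Perm

/-! ### Planarity -/

namespace LinkDiagram

variable {X : Type u} (D : LinkDiagram X)

theorem eq_of_rot_invariant {β : Type*} {g : Dart X → β} (h : ∀ d, g (rot d) = g d)
    {d d' : Dart X} (hd : d.1 = d'.1) : g d = g d' := by
  have key : ∀ (c : X) (i : ZMod 4), g (c, i) = g (c, 0) := by
    intro c i
    have h0 : g (c, 1) = g (c, 0) := h (c, 0)
    have h1 : g (c, 2) = g (c, 1) := h (c, 1)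
    have h2 : g (c, 3) = g (c, 2) := h (c, 2)
    have hi : i = 0 ∨ i = 1 ∨ i = 2 ∨ i = 3 := by revert i; decide
    rcases hi with rfl | rfl | rfl | rfl
    · rfl
    · exact h0
    · exact h1.trans h0
    · exact h2.trans (h1.trans h0)
  obtain ⟨c, i⟩ := d
  obtain ⟨c', j⟩ := d'
  obtain rfl : c = c' := hd
  rw [key, key c j]

theorem sum_dart {β : Type*} [AddCommMonoid β] (g : ZMod 4 → β) :
    ∑ i, g i = g 0 + g 1 + g 2 + g 3 :=
  Fin.sum_univ_four g

theorem face_faceNext (d : Dart X) : D.face (D.faceNext d) = D.face d :=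
  (Quot.sound (r := fun d d' : Dart X => d' = D.faceNext d) rfl).symm

/-- The quadrant `d` lies between the ends `d` and `rot d`, so its region is on the right of `rot
d`. -/
theorem face_opp_rot (d : Dart X) : D.face (D.opp (rot d)) = D.face d := by
  rw [← D.face_faceNext, faceNext, D.opp_opp, rotInv_rot]

/-- The edge with the end `d`. -/
def edge (d : Dart X) : D.Edge := Quot.mk _ d

theorem edge_opp (d : Dart X) : D.edge (D.opp d) = D.edge d :=
  (Quot.sound (r := fun d d' : Dart X => d' = D.opp d) rfl).symm

theorem edge_eq_iff {d d' : Dart X} : D.edge d = D.edge d' ↔ d = d' ∨ d = D.opp d' := by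
  constructor
  · intro h
    have h' := Quot.eqvGen_exact h
    clear h
    induction h' with
    | rel a b h => subst h; exact Or.inr (D.opp_opp a).symm
    | refl a => exact Or.inl rfl
    | symm a b _ ih =>
      rcases ih with rfl | rfl
      · exact Or.inl rfl
      · exact Or.inr (D.opp_opp b).symm
    | trans a b c _ _ ih1 ih2 =>
      rcases ih1 with rfl | rfl
      · exact ih2
      · rcases ih2 with rfl | rfl
        · exact Or.inr rfl
        · exact Or.inl (D.opp_opp c)
  · rintro (rfl | rfl)
    · rfl
    · exact D.edge_opp _

theorem eq_of_component {β : Type*} {g : Dart X → β} (hrot : ∀ d, g (rot d) = g d)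
    (hopp : ∀ d, g (D.opp d) = g d) {d d' : Dart X} (h : D.component d = D.component d') :
    g d = g d' := by
  have h' := Quot.eqvGen_exact h
  clear h
  induction h' with
  | rel a b h =>
    rcases h with h | rfl
    · exact eq_of_rot_invariant hrot h
    · exact (hopp a).symm
  | refl a => rfl
  | symm a b _ ih => exact ih.symm
  | trans a b c _ _ ih1 ih2 => exact ih1.trans ih2

/-- A path which avoids `c`, as a chain modulo 2. -/
theorem exists_chain [DecidableEq X] {c : X} {d d' : Dart X} (h : D.ConnectedAvoiding c d d') :
    ∃ z : Dart X → ZMod 2, (∀ e, z (D.opp e) = z e) ∧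
      (∀ e, e.1 = c → z e = (if e = d then 1 else 0) + if e = d' then 1 else 0) ∧
      ∀ c' ≠ c, ∑ i, z (c', i) = (if d.1 = c' then 1 else 0) + if d'.1 = c' then 1 else 0 := by
  have two : ∀ a : ZMod 2, a + a = 0 := by decide
  induction h with
  | rel a b h =>
    rcases h with rfl | ⟨h, hc⟩
    · refine ⟨fun e => (if e = a then 1 else 0) + if e = D.opp a then 1 else 0, fun e => ?_,
        fun e _ => rfl, fun c' _ => ?_⟩
      · have h1 : D.opp e = a ↔ e = D.opp a :=
          ⟨fun h => by rw [← h, D.opp_opp], fun h => by rw [h, D.opp_opp]⟩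
        simp only [h1, D.opp_injective.eq_iff]
        rw [add_comm]
      · rw [Finset.sum_add_distrib]
        have : ∀ b : Dart X, (∑ i : ZMod 4, if (c', i) = b then (1 : ZMod 2) else 0) =
            if b.1 = c' then 1 else 0 := by
          rintro ⟨b, j⟩
          by_cases hb : b = c'
          · subst hb; simp
          · simp [hb, Ne.symm hb]
        rw [this, this]
    -- Turning from one end to another at a crossing other than `c` uses no edge.
    · refine ⟨fun _ => 0, fun _ => rfl, fun e he => ?_, fun c' _ => ?_⟩
      · rw [if_neg (by rintro rfl; exact hc he), if_neg (by rintro rfl; exact hc (h.trans he)),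
          add_zero]
      · rw [h, two]; simp
  | refl a => exact ⟨fun _ => 0, fun _ => rfl, fun _ _ => (two _).symm, fun _ _ => by simp [two]⟩
  | symm a b _ ih =>
    obtain ⟨z, h1, h2, h3⟩ := ih
    exact ⟨z, h1, fun e he => by rw [h2 e he, add_comm], fun c' h => by rw [h3 c' h, add_comm]⟩
  | trans a b e _ _ ih ih' =>
    obtain ⟨z, h1, h2, h3⟩ := ih
    obtain ⟨z', h1', h2', h3'⟩ := ih'
    have key : ∀ p q r : ZMod 2, p + q + (q + r) = p + r := by decide
    exact ⟨fun e => z e + z' e, fun e => congrArg₂ _ (h1 e) (h1' e),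
      fun e he => by simp only [h2 e he, h2' e he, key],
      fun c' hc => by rw [Finset.sum_add_distrib, h3 c' hc, h3' c' hc, key]⟩

variable [Fintype X]

/-- In a connected planar diagram every cycle modulo 2 bounds a set of regions. -/
theorem exists_coloring (hplanar : D.Planar) (hnonsplit : D.NonSplit) (z : Dart X → ZMod 2)
    (hz : ∀ d, z (D.opp d) = z d) (hsum : ∀ c, ∑ i, z (c, i) = 0) :
    ∃ f : D.Face → ZMod 2, ∀ d, f (D.face d) + f (D.face (D.opp d)) = z d := by
  classical
  obtain ⟨⟨c₀⟩, hconn⟩ := hnonsplit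
  have : Finite D.Face := Finite.of_surjective D.face Quot.mk_surjective
  have : Finite D.Edge := Finite.of_surjective D.edge Quot.mk_surjective
  have := Fintype.ofFinite D.Face
  have := Fintype.ofFinite D.Edge
  have hcomp : Nat.card D.Component = 1 := by
    rw [Nat.card_eq_one_iff_unique]
    refine ⟨⟨fun a b => ?_⟩, ⟨D.component (c₀, 0)⟩⟩
    induction a using Quot.ind with | mk a => ?_
    induction b using Quot.ind with | mk b => ?_
    exact hconn a b
  -- The cellular chain complex modulo 2: `boundary` takes regions to edges, and the incidence
  -- matrix `M` below takes edges to crossings. A loop has both its ends counted and so contributes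
  -- zero to `M`.
  let boundary : (D.Face → ZMod 2) →ₗ[ZMod 2] (D.Edge → ZMod 2) :=
    { toFun := fun f e => Quot.lift (fun d => f (D.face d) + f (D.face (D.opp d)))
        (by rintro d _ rfl; rw [D.opp_opp, add_comm]) e
      map_add' := by
        intro f g
        ext e
        induction e using Quot.ind
        exact add_add_add_comm _ _ _ _
      map_smul' := by
        intro r f
        ext e
        induction e using Quot.ind
        exact (mul_add _ _ _).symm }
  have hb : ∀ f d, boundary f (D.edge d) = f (D.face d) + f (D.face (D.opp d)) := fun f d => rfl
  let M : Matrix X D.Edge (ZMod 2) :=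
    Matrix.of fun c e => ∑ i, if D.edge (c, i) = e then 1 else 0
  have hMe : ∀ c e, M c e = ∑ i, if D.edge (c, i) = e then 1 else 0 := fun c e => rfl
  clear_value M
  have hM : ∀ g c, M.mulVecLin g c = ∑ i, g (D.edge (c, i)) := by
    intro g c
    simp only [Matrix.mulVecLin_apply, Matrix.mulVec, dotProduct, hMe, Finset.sum_mul]
    rw [Finset.sum_comm]
    simp
  have hMT : ∀ f d, M.transpose.mulVecLin f (D.edge d) = f d.1 + f (D.opp d).1 := by
    intro f d
    simp only [Matrix.mulVecLin_apply, Matrix.mulVec, dotProduct, hMe, Finset.sum_mul,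
      Matrix.transpose_apply]
    rw [← Fintype.sum_prod_type' (f := fun (c : X) (i : ZMod 4) =>
      (if D.edge (c, i) = D.edge d then 1 else 0) * f c)]
    simp only [Prod.mk.eta, ite_mul, one_mul, zero_mul, D.edge_eq_iff]
    rw [← Finset.sum_filter, Finset.filter_or, Finset.sum_union]
    · simp [Finset.filter_eq']
    · rw [Finset.disjoint_left]
      intro a h1 h2
      rw [Finset.mem_filter] at h1 h2
      exact D.opp_ne d (h2.2.symm.trans h1.2)
  -- A boundary is a cycle, because each of the four quadrants at a crossing is counted on both of
  -- its sides.
  have hle : LinearMap.range boundary ≤ LinearMap.ker M.mulVecLin := by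
    rintro _ ⟨f, rfl⟩
    rw [LinearMap.mem_ker]
    ext c
    simp only [hM, hb, sum_dart]
    have e0 : D.face (D.opp (c, 1)) = D.face (c, 0) := D.face_opp_rot (c, 0)
    have e1 : D.face (D.opp (c, 2)) = D.face (c, 1) := D.face_opp_rot (c, 1)
    have e2 : D.face (D.opp (c, 3)) = D.face (c, 2) := D.face_opp_rot (c, 2)
    have e3 : D.face (D.opp (c, 0)) = D.face (c, 3) := D.face_opp_rot (c, 3)
    rw [e0, e1, e2, e3]
    have key : ∀ a b p q : ZMod 2, a + q + (b + a) + (p + b) + (q + p) = 0 := by decide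
    exact key _ _ _ _
  have one_ne : ∀ {I : Type u} [Nonempty I], (1 : I → ZMod 2) ≠ 0 := one_ne_zero
  have add_cancel : ∀ a b : ZMod 2, a + b = 0 → b = a := by decide
  -- Connectedness leaves only the constants in the kernels of `boundary` and of the transpose of
  -- `M`.
  have hker : Module.finrank (ZMod 2) (LinearMap.ker boundary) ≤ 1 := by
    have : Nonempty D.Face := ⟨D.face (c₀, 0)⟩
    rw [← finrank_span_singleton (K := ZMod 2) (one_ne (I := D.Face))]
    refine Submodule.finrank_mono fun f hf => Submodule.mem_span_singleton.2
      ⟨f (D.face (c₀, 0)), ?_⟩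
    have hopp : ∀ d, f (D.face (D.opp d)) = f (D.face d) := fun d =>
      add_cancel _ _ (by rw [← hb, LinearMap.mem_ker.1 hf]; rfl)
    ext F
    induction F using Quot.ind with | mk d => ?_
    refine (mul_one _).trans ?_
    exact D.eq_of_component (g := fun d => f (D.face d))
      (fun d => by rw [← hopp, D.face_opp_rot]) hopp (hconn _ _)
  have hkerT : Module.finrank (ZMod 2) (LinearMap.ker M.transpose.mulVecLin) ≤ 1 := by
    have : Nonempty X := ⟨c₀⟩
    rw [← finrank_span_singleton (K := ZMod 2) (one_ne (I := X))]
    refine Submodule.finrank_mono fun f hf => Submodule.mem_span_singleton.2 ⟨f c₀, ?_⟩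
    have hopp : ∀ d : Dart X, f (D.opp d).1 = f d.1 := fun d =>
      add_cancel _ _ (by rw [← hMT, LinearMap.mem_ker.1 hf]; rfl)
    ext c
    simp only [Pi.smul_apply, Pi.one_apply, smul_eq_mul, mul_one]
    exact D.eq_of_component (g := fun d => f d.1) (fun d => rfl) hopp (hconn (c₀, 0) (c, 0))
  have h1 := LinearMap.finrank_range_add_finrank_ker boundary
  have h2 := LinearMap.finrank_range_add_finrank_ker M.mulVecLin
  have h3 := LinearMap.finrank_range_add_finrank_ker M.transpose.mulVecLin
  have h4 : Module.finrank (ZMod 2) (LinearMap.range M.transpose.mulVecLin) =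
    Module.finrank (ZMod 2) (LinearMap.range M.mulVecLin) := M.rank_transpose
  rw [Module.finrank_fintype_fun_eq_card] at h1 h2 h3
  have h5 : Nat.card X + Nat.card D.Face = Nat.card D.Edge + 2 * Nat.card D.Component := hplanar
  rw [hcomp, Nat.card_eq_fintype_card, Nat.card_eq_fintype_card, Nat.card_eq_fintype_card] at h5
  -- With $V$, $E$, $F$ the numbers of crossings, edges and regions, the image of `boundary` has
  -- dimension at least $F-1$. The kernel of `M` has dimension at most $E-(V-1)$, because `M` and
  -- its transpose have equal rank. Euler's formula makes these two bounds equal.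
  have heq := Submodule.eq_of_le_of_finrank_le hle (by omega)
  let g : D.Edge → ZMod 2 := Quot.lift z (by rintro d _ rfl; exact (hz d).symm)
  have hg : g ∈ LinearMap.ker M.mulVecLin := by
    rw [LinearMap.mem_ker]
    ext c
    rw [hM]
    exact hsum c
  rw [← heq] at hg
  obtain ⟨f, hf⟩ := hg
  exact ⟨f, fun d => by rw [← hb, hf]; rfl⟩

/-- The regions of a connected planar diagram have a checkerboard colouring. -/
theorem exists_checkerboard (hplanar : D.Planar) (hnonsplit : D.NonSplit) :
    ∃ κ : Dart X → Bool, (∀ d, κ (D.opp d) = !κ d) ∧ ∀ d, κ (rot d) = !κ d := by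
  -- The sum of all edges is a cycle, since every crossing has the even valency 4.
  obtain ⟨f, hf⟩ := D.exists_coloring hplanar hnonsplit (fun _ => 1) (fun _ => rfl)
    (fun c => by rw [sum_dart]; decide)
  have key : ∀ a b : ZMod 2, a + b = 1 → decide (b = 0) = !decide (a = 0) := by decide
  refine ⟨fun d => decide (f (D.face d) = 0), fun d => key _ _ (hf d), fun d => key _ _ ?_⟩
  rw [← hf (rot d), D.face_opp_rot, add_comm]

/-- In a reduced planar diagram opposite quadrants at a crossing are in different regions. -/
theorem face_ne_of_reduced (hplanar : D.Planar) (hnonsplit : D.NonSplit) (hreduced : D.Reduced)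
    (d : Dart X) : D.face (rot (rot d)) ≠ D.face d := by
  classical
  intro hface
  -- A path from `d` to `rot d` avoiding the crossing closes up to a cycle that uses only these two
  -- ends there. A function on the regions which it bounds changes across `rot d` but not across
  -- `rot (rot d)`, so it differs on the two opposite quadrants.
  have hconn : D.ConnectedAvoiding d.1 d (rot d) := by
    by_contra h
    exact hreduced d.1 ⟨d, rot d, hnonsplit.2 _ _, h⟩
  obtain ⟨z, hz, hzc, hzs⟩ := D.exists_chain hconn
  have hne : ∀ i : ZMod 4, i + 1 + 1 ≠ i ∧ i + 1 + 1 ≠ i + 1 ∧ i + 1 ≠ i := by decide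
  have hsum : ∀ c, ∑ i, z (c, i) = 0 := by
    intro c
    by_cases hc : c = d.1
    · have h1 : ∀ i, z (c, i) = (if i = d.2 then 1 else 0) + if i = d.2 + 1 then 1 else 0 := by
        intro i
        rw [hzc _ hc]
        subst hc
        simp [rot, Prod.ext_iff]
      simp only [h1, Finset.sum_add_distrib, Finset.sum_ite_eq', Finset.mem_univ, if_true]
      decide
    · rw [hzs c hc]
      have : (rot d).1 = d.1 := rfl
      rw [this]
      split_ifs <;> decide
  obtain ⟨f, hf⟩ := D.exists_coloring hplanar hnonsplit z hz hsum
  have h1 := hf (rot d)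
  have h2 := hf (rot (rot d))
  have h10 : ¬ (1 : ZMod 4) = 0 := by decide
  have hd : d.2 + 1 + 1 ≠ d.2 ∧ d.2 + 1 + 1 ≠ d.2 + 1 ∧ d.2 + 1 ≠ d.2 := hne _
  rw [D.face_opp_rot, hzc (rot d) rfl, if_neg (by simp [rot, Prod.ext_iff, h10]), if_pos rfl] at h1
  rw [D.face_opp_rot, hzc (rot (rot d)) rfl, if_neg (by simpa [rot, Prod.ext_iff] using hd.1),
    if_neg (by simp [rot, Prod.ext_iff, h10]), hface] at h2
  generalize f (D.face d) = a at h1 h2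
  generalize f (D.face (rot d)) = b at h1 h2
  revert a b
  decide

end LinkDiagram

theorem Relation.EqvGen.map {α β : Type*} {r : α → α → Prop} {s : β → β → Prop} (f : α → β)
    (h : ∀ a b, r a b → Relation.EqvGen s (f a) (f b)) {a b : α} (hab : Relation.EqvGen r a b) :
    Relation.EqvGen s (f a) (f b) := by
  induction hab with
  | rel a b hr => exact h a b hr
  | refl a => exact Relation.EqvGen.refl _
  | symm a b _ ih => exact ih.symm
  | trans a b c _ _ ih1 ih2 => exact ih1.trans _ _ _ ih2

/-! ### State circles as orbits of a permutation -/

namespace LinkDiagram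

variable {X : Type u}

theorem splitMate_fst (m : Marker) (d : Dart X) : (splitMate m d).1 = d.1 := by
  unfold splitMate; split_ifs <;> rfl

theorem quadrant_splitMate (m : Marker) (d : Dart X) :
    quadrant (splitMate m d) = m ↔ quadrant d ≠ m := by
  unfold splitMate
  split_ifs with h
  · exact ⟨fun h1 _ => (quadrant_ne_iff d m).2 h1 h, fun h1 => absurd h h1⟩
  · have h1 := quadrant_ne_iff (rot d) m
    rw [rotInv_rot] at h1
    simp only [h, ne_eq, iff_false, not_not] at h1
    simp [h, h1]

theorem splitMate_splitMate (m : Marker) (d : Dart X) : splitMate m (splitMate m d) = d := by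
  have h1 := quadrant_splitMate m d
  by_cases h : quadrant d = m
  · have h2 : splitMate m d = rotInv d := if_pos h
    have h3 : quadrant (splitMate m d) ≠ m := fun h4 => h1.1 h4 h
    rw [h2] at h3 ⊢
    rw [splitMate, if_neg h3, rot_rotInv]
  · have h2 : splitMate m d = rot d := if_neg h
    have h3 := h1.2 h
    rw [h2] at h3 ⊢
    rw [splitMate, if_pos h3, rotInv_rot]

theorem rotInv_eq (d : Dart X) : rotInv d = rot (rot (rot d)) := by
  have : ∀ i : ZMod 4, i - 1 = i + 1 + 1 + 1 := by decide
  exact Prod.ext rfl (this d.2)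

theorem rot_rot_rot_rot (d : Dart X) : rot (rot (rot (rot d))) = d := by
  rw [← rotInv_eq, rotInv_rot]

/-- The two splittings join an end to its two neighbours, which are opposite each other. This is why
changing a label acts as a transposition. -/
theorem splitMate_of_ne {m m' : Marker} (h : m ≠ m') (d : Dart X) :
    splitMate m' d = rot (rot (splitMate m d)) := by
  unfold splitMate
  by_cases hd : quadrant d = m
  · rw [if_pos hd, if_neg (fun h1 => h (hd.symm.trans h1)), rotInv_eq, rot_rot_rot_rot]
  · have hd' : quadrant d = m' := by
      revert hd h; generalize quadrant d = x; cases x <;> cases m <;> cases m' <;> simp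
    rw [if_neg hd, if_pos hd', rotInv_eq]

/-- The quadrant which the `m`-splitting strand at `d` goes round. -/
def corner (m : Marker) (d : Dart X) : Dart X := if quadrant d = m then rotInv d else d

theorem corner_fst (m : Marker) (d : Dart X) : (corner m d).1 = d.1 := by
  unfold corner; split_ifs <;> rfl

theorem quadrant_corner (m : Marker) (d : Dart X) : quadrant (corner m d) ≠ m := by
  unfold corner
  split_ifs with h
  · intro h1; exact (quadrant_ne_iff d m).2 h1 h
  · exact h

theorem corner_of_quadrant_ne {m : Marker} {d : Dart X} (h : quadrant d ≠ m) : corner m d = d :=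
  if_neg h

theorem corner_rot {m : Marker} {q : Dart X} (h : quadrant q ≠ m) : corner m (rot q) = q := by
  have : quadrant (rot q) = m := by
    have h1 := quadrant_ne_iff (rot q) m
    rw [rotInv_rot] at h1
    by_contra h2
    exact h (h1.1 h2)
  rw [corner, if_pos this, rotInv_rot]

theorem corner_splitMate (m : Marker) (d : Dart X) : corner m (splitMate m d) = corner m d := by
  by_cases h : quadrant d = m
  · have h1 : splitMate m d = rotInv d := if_pos h
    have h2 : quadrant (rotInv d) ≠ m := fun h3 => (quadrant_ne_iff d m).2 h3 h
    rw [h1, corner_of_quadrant_ne h2, corner, if_pos h]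
  · have h1 : splitMate m d = rot d := if_neg h
    rw [h1, corner_rot h, corner_of_quadrant_ne h]

/-- The corner of a dart lies on the same circle of the extreme state as the dart. -/
theorem stateCircle_corner (D : LinkDiagram X) (m : Marker) (d : Dart X) :
    D.stateCircle (extremeState X m) (corner m d) = D.stateCircle (extremeState X m) d := by
  unfold corner
  split_ifs with h
  · have h1 := D.stateCircle_splitMate (extremeState X m) d
    rwa [splitMate, if_pos (by exact h)] at h1
  · rfl

/-- A checkerboard colouring, as an orientation of the edges with the coloured regions on the
left. -/
structure Checkerboard (D : LinkDiagram X) where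
  /-- The edge is oriented away from the end. -/
  out : Dart X → Bool
  out_opp : ∀ d, out (D.opp d) = !out d
  out_rot : ∀ d, out (rot d) = !out d

namespace Checkerboard

variable {D : LinkDiagram X} (K : D.Checkerboard)

/-- The outgoing darts. -/
abbrev Out : Type _ := {d : Dart X // K.out d = true}

theorem out_rotInv (d : Dart X) : K.out (rotInv d) = !K.out d := by
  rw [← rot_rotInv d, K.out_rot, rot_rotInv, Bool.not_not]

/-- Both splittings join an outgoing end to an incoming one, so a single orientation serves all
states. -/
theorem out_splitMate (m : Marker) (d : Dart X) : K.out (splitMate m d) = !K.out d := by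
  unfold splitMate
  split_ifs
  · exact K.out_rotInv d
  · exact K.out_rot d

/-- Follow the outgoing edge, then the splitting at its other end. -/
def perm (s : X → Marker) : Equiv.Perm K.Out where
  toFun d := ⟨splitMate (s (D.opp d.1).1) (D.opp d.1), by
    rw [K.out_splitMate, K.out_opp, Bool.not_not, d.2]⟩
  invFun d := ⟨D.opp (splitMate (s d.1.1) d.1), by
    rw [K.out_opp, K.out_splitMate, Bool.not_not, d.2]⟩
  left_inv d := by
    ext1
    dsimp only
    rw [splitMate_fst, splitMate_splitMate, D.opp_opp]
  right_inv d := by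
    ext1
    dsimp only
    rw [D.opp_opp, splitMate_fst, splitMate_splitMate]

theorem perm_val (s : X → Marker) (d : K.Out) :
    (K.perm s d).1 = splitMate (s (D.opp d.1).1) (D.opp d.1) := rfl

/-- The outgoing end of the edge of `d`. -/
def tail (d : Dart X) : K.Out :=
  if h : K.out d = true then ⟨d, h⟩ else ⟨D.opp d, by rw [K.out_opp]; simpa using h⟩

theorem tail_of_out (d : K.Out) : K.tail d.1 = d := dif_pos d.2

theorem tail_opp (d : Dart X) : K.tail (D.opp d) = K.tail d := by
  by_cases h : K.out d = true
  · have h1 : ¬ K.out (D.opp d) = true := by rw [K.out_opp, h]; simp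
    rw [tail, dif_neg h1, tail, dif_pos h]
    exact Subtype.ext (D.opp_opp d)
  · have h1 : K.out (D.opp d) = true := by rw [K.out_opp]; simpa using h
    rw [tail, dif_pos h1, tail, dif_neg h]

/-- Of `d` and its mate one is incoming, and `perm` carries the tail of that one's edge to the
other. -/
theorem sameCycle_tail_splitMate (s : X → Marker) (d : Dart X) :
    (K.perm s).SameCycle (K.tail d) (K.tail (splitMate (s d.1) d)) := by
  by_cases h : K.out d = true
  · refine Equiv.Perm.SameCycle.symm ?_
    have h1 := (K.perm s).sameCycle_apply_self (K.tail (splitMate (s d.1) d))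
    have h2 : K.perm s (K.tail (splitMate (s d.1) d)) = K.tail d := by
      rw [← K.tail_opp (splitMate _ _)]
      have h3 : K.out (D.opp (splitMate (s d.1) d)) = true := by
        rw [K.out_opp, K.out_splitMate, Bool.not_not, h]
      have h4 : K.tail (D.opp (splitMate (s d.1) d)) = ⟨_, h3⟩ := dif_pos h3
      rw [h4]
      ext1
      rw [perm_val, tail, dif_pos h]
      dsimp only
      rw [D.opp_opp, splitMate_fst, splitMate_splitMate]
    rwa [h2] at h1
  · have h1 := (K.perm s).sameCycle_apply_self (K.tail d)
    have h2 : K.perm s (K.tail d) = K.tail (splitMate (s d.1) d) := by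
      have h3 : K.out (splitMate (s d.1) d) = true := by
        rw [K.out_splitMate]; simpa using h
      ext1
      rw [perm_val, tail, dif_neg h, tail, dif_pos h3]
      dsimp only
      rw [D.opp_opp]
    rwa [h2] at h1

theorem stateCircle_eq_iff_tail (s : X → Marker) (d d' : Dart X) :
    D.stateCircle s d = D.stateCircle s d' ↔ (K.perm s).SameCycle (K.tail d) (K.tail d') := by
  constructor
  · intro h
    have h' := Quot.eqvGen_exact h
    clear h
    induction h' with
    | rel a b h =>
      rcases h with rfl | rfl
      · rw [tail_opp]
      · exact K.sameCycle_tail_splitMate s a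
    | refl a => exact Equiv.Perm.SameCycle.refl _ _
    | symm a b _ ih => exact ih.symm
    | trans a b c _ _ ih1 ih2 => exact ih1.trans ih2
  · have htail : ∀ d, D.stateCircle s (K.tail d).1 = D.stateCircle s d := by
      intro d
      unfold tail
      split_ifs
      · rfl
      · exact D.stateCircle_opp s d
    have hstep : ∀ u : K.Out, D.stateCircle s (K.perm s u).1 = D.stateCircle s u.1 := fun u => by
      rw [perm_val, D.stateCircle_splitMate, D.stateCircle_opp]
    rintro ⟨i, hi⟩
    rw [← htail d, ← htail d', ← hi]
    clear hi
    induction i with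
    | zero => rfl
    | succ i ih =>
      rw [ih, add_comm, zpow_add, Equiv.Perm.mul_apply, zpow_one, hstep]
    | pred i ih =>
      rw [ih, ← hstep ((K.perm s ^ (-(i : ℤ) - 1)) (K.tail d)), ← Equiv.Perm.mul_apply,
        ← zpow_one_add, add_sub_cancel]

theorem stateCircle_eq_iff (s : X → Marker) (u v : K.Out) :
    D.stateCircle s u.1 = D.stateCircle s v.1 ↔ (K.perm s).SameCycle u v := by
  rw [K.stateCircle_eq_iff_tail, tail_of_out, tail_of_out]

theorem circleCount_eq (s : X → Marker) : D.circleCount s = (K.perm s).orbitCount := by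
  refine (Nat.card_congr (Equiv.ofBijective (Quotient.lift (s := Equiv.Perm.SameCycle.setoid _)
    (fun u : K.Out => D.stateCircle s u.1) fun u v h => (K.stateCircle_eq_iff s u v).2 h)
    ⟨?_, ?_⟩)).symm
  · intro a b hab
    induction a using Quotient.inductionOn with | h a => ?_
    induction b using Quotient.inductionOn with | h b => ?_
    exact Quotient.sound ((K.stateCircle_eq_iff s a b).1 hab)
  · intro C
    induction C using Quot.ind with | mk d => ?_
    refine ⟨Quotient.mk _ (K.tail d), ?_⟩
    exact (K.stateCircle_eq_iff_tail s _ _).2 (by rw [K.tail_of_out])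

/-- The outgoing end next to the quadrant `q`. -/
def exit (q : Dart X) : K.Out :=
  if h : K.out q = true then ⟨q, h⟩ else ⟨rot q, by rw [K.out_rot]; simpa using h⟩

theorem exit_fst (q : Dart X) : (K.exit q).1.1 = q.1 := by
  unfold exit; split_ifs <;> rfl

theorem exit_rot_rot (q : Dart X) : (K.exit (rot (rot q))).1 = rot (rot (K.exit q).1) := by
  have h1 : K.out (rot (rot q)) = K.out q := by rw [K.out_rot, K.out_rot, Bool.not_not]
  by_cases h : K.out q = true
  · rw [exit, dif_pos (h1.trans h), exit, dif_pos h]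
  · rw [exit, dif_neg (h1 ▸ h), exit, dif_neg h]

theorem exit_ne (q : Dart X) : K.exit q ≠ K.exit (rot (rot q)) := by
  intro h
  have h1 := congrArg (fun u : K.Out => u.1.2) h
  rw [exit_rot_rot] at h1
  have : ∀ i : ZMod 4, i ≠ i + 1 + 1 := by decide
  exact this _ h1

theorem eq_exit_or (q : Dart X) (u : K.Out) (h : u.1.1 = q.1) :
    u = K.exit q ∨ u = K.exit (rot (rot q)) := by
  suffices H : u.1 = (K.exit q).1 ∨ u.1 = rot (rot (K.exit q).1) by
    rcases H with H | H
    · exact Or.inl (Subtype.ext H)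
    · exact Or.inr (Subtype.ext (by rw [H, exit_rot_rot]))
  have key : ∀ u v : Dart X, u.1 = v.1 → K.out u = true → K.out v = true →
      u = v ∨ u = rot (rot v) := by
    have hZ : ∀ i j : ZMod 4, i = j ∨ i = j + 1 ∨ i = j + 1 + 1 ∨ i = j + 1 + 1 + 1 := by
      decide
    rintro ⟨c, i⟩ v rfl hu hv
    have hi : i = v.2 ∨ i = v.2 + 1 ∨ i = v.2 + 1 + 1 ∨ i = v.2 + 1 + 1 + 1 := by
      exact hZ i v.2
    rcases hi with rfl | rfl | rfl | rfl
    · exact Or.inl rfl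
    · have := K.out_rot v
      rw [show rot v = (v.1, v.2 + 1) from rfl, hu, hv] at this
      exact absurd this (by simp)
    · exact Or.inr rfl
    · have := K.out_rot (rot (rot v))
      rw [show rot (rot (rot v)) = (v.1, v.2 + 1 + 1 + 1) from rfl, hu, K.out_rot, K.out_rot,
        hv] at this
      exact absurd this (by simp)
  exact key _ _ (h.trans (K.exit_fst q).symm) u.2 (K.exit q).2

/-- Each strand of the extreme splitting has one outgoing end and goes round one quadrant. Hence
`exit` and `corner m` are inverse bijections between the quadrants not labelled `m` and the outgoing
ends. -/
theorem corner_exit {m : Marker} {q : Dart X} (hq : quadrant q ≠ m) :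
    corner m (K.exit q).1 = q := by
  unfold exit
  split_ifs
  · exact corner_of_quadrant_ne hq
  · exact corner_rot hq

theorem exit_corner (m : Marker) (u : K.Out) : K.exit (corner m u.1) = u := by
  unfold corner
  split_ifs
  · have h : ¬ K.out (rotInv u.1) = true := by rw [K.out_rotInv, u.2]; simp
    rw [exit, dif_neg h]
    exact Subtype.ext (rot_rotInv _)
  · exact dif_pos u.2

theorem perm_flip [DecidableEq X] {s s' : X → Marker} {c : X} (hc : s c ≠ s' c)
    (h : ∀ c' ≠ c, s' c' = s c') : K.perm s' =
      Equiv.swap (K.exit (c, 0)) (K.exit (rot (rot (c, 0)))) * K.perm s := by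
  ext1 d
  rw [Equiv.Perm.mul_apply]
  by_cases hd : (D.opp d.1).1 = c
  · have h1 : (K.perm s' d).1 = rot (rot (K.perm s d).1) := by
      rw [perm_val, perm_val, hd, splitMate_of_ne hc]
    have h2 : (K.perm s d).1.1 = c := by rw [perm_val, splitMate_fst, hd]
    rcases K.eq_exit_or (c, 0) _ h2 with h3 | h3
    · rw [h3, Equiv.swap_apply_left]
      exact Subtype.ext (by rw [h1, h3, exit_rot_rot])
    · rw [h3, Equiv.swap_apply_right]
      exact Subtype.ext (by rw [h1, h3, exit_rot_rot, rot_rot_rot_rot])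
  · have h2 : (K.perm s d).1.1 ≠ c := by rwa [perm_val, splitMate_fst]
    have h3 : K.perm s' d = K.perm s d := Subtype.ext (by rw [perm_val, perm_val, h _ hd])
    rw [h3, Equiv.swap_apply_of_ne_of_ne]
    · intro h4; apply h2; rw [h4, exit_fst]
    · intro h4; apply h2; rw [h4, exit_fst]; rfl

/-- Two points of the circles of an extreme state are joined by a segment. -/
theorem segment_iff {m : Marker} {q q' : Dart X} (hq : quadrant q ≠ m) (hq' : quadrant q' ≠ m) :
    (∃ b b', sideDart q' b' = D.opp (sideDart q b)) ↔
      K.exit q' = K.perm (extremeState X m) (K.exit q) ∨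
        K.exit q = K.perm (extremeState X m) (K.exit q') := by
  have hside : ∀ {q : Dart X} (_ : quadrant q ≠ m) (e : Dart X),
      (∃ b, sideDart q b = e) ↔ e = (K.exit q).1 ∨ e = splitMate m (K.exit q).1 := by
    intro q hq e
    have h1 : splitMate m q = rot q := if_neg hq
    have h2 : splitMate m (rot q) = q := by rw [← h1, splitMate_splitMate]
    unfold exit
    simp only [Bool.exists_bool, sideDart, Bool.false_eq_true, if_false, if_true]
    split_ifs
    · rw [h1, or_comm, eq_comm, @eq_comm _ (rot q)]
    · rw [h2, eq_comm, @eq_comm _ q]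
  have hperm : ∀ u v : K.Out, v = K.perm (extremeState X m) u ↔
      D.opp u.1 = splitMate m v.1 := by
    intro u v
    rw [Subtype.ext_iff, perm_val]
    constructor
    · intro h; rw [h]; exact (splitMate_splitMate m _).symm
    · intro h; rw [h]; exact (splitMate_splitMate m _).symm
  -- A segment runs along one edge, so it leaves one of its points by the exit and enters the other
  -- by the mate of the exit. The orientation rules out the other combinations.
  have hcol : ∀ u v : K.Out, D.opp u.1 ≠ v.1 := by
    intro u v h
    have h1 := K.out_opp u.1
    rw [h, v.2, u.2] at h1
    exact absurd h1 (by simp)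
  have hcol' : ∀ u v : K.Out, D.opp (splitMate m u.1) ≠ splitMate m v.1 := by
    intro u v h
    have h1 := K.out_opp (splitMate m u.1)
    rw [h, K.out_splitMate, K.out_splitMate, v.2, u.2] at h1
    exact absurd h1 (by simp)
  rw [hperm, hperm]
  constructor
  · rintro ⟨b, b', h⟩
    have h1 := (hside hq _).1 ⟨b, rfl⟩
    have h2 := (hside hq' _).1 ⟨b', rfl⟩
    rw [h] at h2
    rcases h1 with h1 | h1 <;> rw [h1] at h2
    · rcases h2 with h2 | h2
      · exact absurd h2 (hcol _ _)
      · exact Or.inl h2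
    · rcases h2 with h2 | h2
      · exact Or.inr (by rw [← h2, D.opp_opp])
      · exact absurd h2 (hcol' _ _)
  · rintro (h | h)
    · obtain ⟨b, hb⟩ := (hside hq _).2 (Or.inl rfl)
      obtain ⟨b', hb'⟩ := (hside hq' _).2 (Or.inr h)
      exact ⟨b, b', by rw [hb, hb']⟩
    · obtain ⟨b, hb⟩ := (hside hq _).2 (Or.inr h)
      obtain ⟨b', hb'⟩ := (hside hq' _).2 (Or.inl rfl)
      exact ⟨b, b', by rw [hb, hb', D.opp_opp]⟩

/-- Chords at different crossings are unlinked just when surgery along the one does not separate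
the ends of the other. -/
theorem joined_iff [Finite X] [DecidableEq X] {m : Marker} {c : X} {s : X → Marker} (hsc : s c ≠ m)
    (hs : ∀ c' ≠ c, s c' = m)
    (hc : D.stateCircle (extremeState X m) (K.exit (c, 0)).1 =
      D.stateCircle (extremeState X m) (K.exit (rot (rot (c, 0)))).1)
    {q q' : Dart X} (hq : quadrant q ≠ m) (hq' : quadrant q' ≠ m) (hqc : q.1 ≠ c)
    (hqc' : q'.1 ≠ c) :
    Relation.EqvGen (fun q q' => (quadrant q ≠ m ∧ quadrant q' ≠ m) ∧ (q.1 ≠ c ∧ q'.1 ≠ c) ∧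
      ∃ b b', sideDart q' b' = D.opp (sideDart q b)) q q' ↔
      (K.perm s).SameCycle (K.exit q) (K.exit q') := by
  rw [K.perm_flip (s := extremeState X m) (c := c) hsc.symm hs, K.stateCircle_eq_iff] at *
  have hat : ∀ u : K.Out, (u ≠ K.exit (c, 0) ∧ u ≠ K.exit (rot (rot (c, 0)))) ↔ u.1.1 ≠ c := by
    intro u
    constructor
    · rintro ⟨h1, h2⟩ h
      rcases K.eq_exit_or (c, 0) u h with h3 | h3
      · exact h1 h3
      · exact h2 h3
    · intro h
      constructor
      · rintro rfl; exact h (K.exit_fst _)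
      · rintro rfl; exact h (K.exit_fst _)
  obtain ⟨h1, h2⟩ := (hat (K.exit q)).2 (by rwa [exit_fst])
  obtain ⟨h3, h4⟩ := (hat (K.exit q')).2 (by rwa [exit_fst])
  -- Paths among quadrants and paths among outgoing ends are carried to each other by `exit` and
  -- `corner m`.
  rw [← Equiv.Perm.eqvGen_avoiding_iff hc (K.exit_ne _) h1 h2 h3 h4]
  simp only [hat]
  constructor
  · refine Relation.EqvGen.map K.exit ?_
    rintro a b ⟨⟨ha, hb⟩, ⟨hac, hbc⟩, hab⟩
    rcases (K.segment_iff ha hb).1 hab with h | h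
    · exact Relation.EqvGen.rel _ _ ⟨h, by rwa [exit_fst], by rwa [exit_fst]⟩
    · exact (Relation.EqvGen.rel _ _ ⟨h, by rwa [exit_fst], by rwa [exit_fst]⟩).symm
  · intro h
    rw [← K.corner_exit hq, ← K.corner_exit hq']
    refine Relation.EqvGen.map (fun u : K.Out => corner m u.1) ?_ h
    rintro u v ⟨huv, hu, hv⟩
    refine Relation.EqvGen.rel _ _ ⟨⟨quadrant_corner _ _, quadrant_corner _ _⟩,
      ⟨by rwa [corner_fst], by rwa [corner_fst]⟩, ?_⟩
    rw [K.segment_iff (quadrant_corner _ _) (quadrant_corner _ _), exit_corner, exit_corner]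
    exact Or.inl huv

end Checkerboard

end LinkDiagram

/-! ### The skeleton and the state circles -/

namespace LinkDiagram

variable {X : Type u} (D : LinkDiagram X)

theorem face_of_inAngle {a q : Dart X} (h : D.InAngle a q) : D.face q = D.face a := by
  obtain ⟨n, rfl, -⟩ := h
  induction n + 1 with
  | zero => rfl
  | succ n ih => rw [Function.iterate_succ_apply', D.face_faceNext, ih]

/-- Along alternating edges the label of the corner does not change from one corner of a region to
the next, while it changes just after a non-alternating edge. So `b` has the label that `a` has not.
-/
theorem skeletonNext_sign {a b : Dart X} (ha : D.NonAlt a) (h : D.SkeletonNext a b) :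
    (D.IsPlus a ∧ D.IsMinus b) ∨ (D.IsMinus a ∧ D.IsPlus b) := by
  have h1 := D.quadrant_of_inAngle ((D.isFirst_iff (quadrant a) a).2 ⟨ha, rfl⟩) h.1
  have h2 : ¬ (IsOver b ↔ IsOver a) := fun h3 => h1 (quadrant_eq_iff.2 h3)
  have h3 := h.2
  unfold NonAlt IsPlus IsMinus at *
  tauto

theorem existsUnique_skeletonNext [Finite X] {a : Dart X} (ha : D.NonAlt a) :
    ∃! b, D.SkeletonNext a b := by
  classical
  obtain ⟨n, hn, hb'⟩ : ∃ n, 0 < n ∧ D.faceNext^[n] a = a :=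
    D.faceNext_injective.mem_periodicPts a
  -- A full turn round the region leads back to `a`, so the search for the next half-edge ends.
  have hex : ∃ j, D.NonAlt (D.faceNext^[j + 1] a) :=
    ⟨n - 1, by rwa [Nat.sub_add_cancel hn, hb']⟩
  refine ⟨D.faceNext^[Nat.find hex + 1] a, ⟨⟨_, rfl, fun k hk => Nat.find_min hex hk⟩,
    Nat.find_spec hex⟩, ?_⟩
  rintro b ⟨⟨k, rfl, hk⟩, hb⟩
  have : k = Nat.find hex := by
    refine le_antisymm ?_ (Nat.find_min' hex hb)
    by_contra h
    exact hk _ (not_le.1 h) (Nat.find_spec hex)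
  rw [this]

theorem existsUnique_skeletonPrev [Finite X] {b : Dart X} (hb : D.NonAlt b) :
    ∃! a, D.NonAlt a ∧ D.SkeletonNext a b := by
  obtain ⟨a, ha, hab⟩ := D.exists_inAngle hb
  exact ⟨a, ⟨ha, hab, hb⟩, fun a' h => D.inAngle_injective h.1 ha h.2.1 hab⟩

theorem isFirst_of_inAngle {m : Marker} {a q : Dart X} (ha : D.NonAlt a) (h : D.InAngle a q)
    (hq : quadrant q ≠ m) : D.IsFirst m a := by
  have h1 := D.quadrant_of_inAngle ((D.isFirst_iff (quadrant a) a).2 ⟨ha, rfl⟩) h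
  refine (D.isFirst_iff m a).2 ⟨ha, ?_⟩
  revert h1 hq
  generalize quadrant a = x
  generalize quadrant q = y
  cases x <;> cases y <;> cases m <;> simp

/-- In a region with a vertex of the skeleton, each radial arc lies in an angle of the skeleton. -/
theorem exists_first_of_vertex [Finite X] {m : Marker} {q : Dart X} (hq : quadrant q ≠ m)
    (h : D.IsSkeletonVertex (D.face q)) : ∃ a, D.IsFirst m a ∧ D.InAngle a q := by
  obtain ⟨d, hd, hdq⟩ := h
  -- Lying in some angle passes from each corner to the next in both directions, so it holds all
  -- round a region or nowhere in it.
  have step : ∀ e, (∃ a, D.NonAlt a ∧ D.InAngle a e) ↔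
      ∃ a, D.NonAlt a ∧ D.InAngle a (D.faceNext e) := by
    intro e
    by_cases he : D.NonAlt e
    · exact ⟨fun _ => ⟨e, he, D.inAngle_faceNext e⟩, fun _ => D.exists_inAngle he⟩
    · constructor
      · rintro ⟨a, ha, hae⟩
        exact ⟨a, ha, D.inAngle_succ hae he⟩
      · rintro ⟨a, ha, hae⟩
        rcases D.inAngle_cases hae with h | ⟨q', h1, h2, h3⟩
        · exact absurd (D.faceNext_injective h ▸ ha) he
        · exact ⟨a, ha, D.faceNext_injective h3 ▸ h1⟩
  have key : ∀ {e e'}, D.face e = D.face e' → ((∃ a, D.NonAlt a ∧ D.InAngle a e) ↔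
      ∃ a, D.NonAlt a ∧ D.InAngle a e') := by
    intro e e' h
    have h' := Quot.eqvGen_exact h
    clear h
    induction h' with
    | rel a b h => rw [h]; exact step a
    | refl a => rfl
    | symm a b _ ih => exact ih.symm
    | trans a b c _ _ ih1 ih2 => exact ih1.trans ih2
  obtain ⟨a, ha, haq⟩ := (key hdq).1 (D.exists_inAngle hd)
  exact ⟨a, D.isFirst_of_inAngle ha haq hq, haq⟩

/-- Invariance along edges is asked for only on the circle in question, so that it may depend on the
edges of this circle being alternating. -/
theorem stateCircle_induction {s : X → Marker} {β : Type*} (g : Dart X → β) {d d' : Dart X}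
    (h : D.stateCircle s d = D.stateCircle s d')
    (hopp : ∀ e, D.stateCircle s e = D.stateCircle s d → g (D.opp e) = g e)
    (hsplit : ∀ e, g (splitMate (s e.1) e) = g e) : g d = g d' := by
  have h' := Quot.eqvGen_exact h
  clear h
  induction h' with
  | rel a b h =>
    rcases h with rfl | rfl
    · exact (hopp a rfl).symm
    · exact (hsplit a).symm
  | refl a => rfl
  | symm a b hab ih =>
    have e : D.stateCircle s a = D.stateCircle s b := Quot.eqvGen_sound hab
    exact (ih (by rwa [e])).symm
  | trans a b c hab _ ih1 ih2 =>
    have e : D.stateCircle s a = D.stateCircle s b := Quot.eqvGen_sound hab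
    exact (ih1 hopp).trans (ih2 (by rwa [← e]))

/-- The ends of an alternating edge have different labels, so the circle turns to the same side of
the edge at both of them, and the two corners are successive in one region. -/
theorem corner_opp_of_alt (m : Marker) {d : Dart X} (h : ¬ D.NonAlt d) :
    (¬ D.NonAlt (corner m d) ∧ corner m (D.opp d) = D.faceNext (corner m d)) ∨
      (¬ D.NonAlt (corner m (D.opp d)) ∧ corner m d = D.faceNext (corner m (D.opp d))) := by
  have h1 : quadrant d ≠ quadrant (D.opp d) := fun h2 => h (quadrant_eq_iff.1 h2)
  by_cases hd : quadrant d = m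
  · have h2 : quadrant (D.opp d) ≠ m := fun h3 => h1 (hd.trans h3.symm)
    refine Or.inr ⟨?_, ?_⟩
    · rw [corner_of_quadrant_ne h2]
      exact fun h3 => h (by have := D.nonAlt_opp h3; rwa [D.opp_opp] at this)
    · rw [corner_of_quadrant_ne h2, corner, if_pos hd, faceNext, D.opp_opp]
  · have h2 : quadrant (D.opp d) = m := by
      revert h1 hd
      generalize quadrant d = x
      generalize quadrant (D.opp d) = y
      cases x <;> cases y <;> cases m <;> simp
    refine Or.inl ⟨?_, ?_⟩
    · rwa [corner_of_quadrant_ne hd]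
    · rw [corner_of_quadrant_ne hd, corner, if_pos h2, faceNext]

/-- The ends of a non-alternating edge have equal labels, so the circle turns to different sides of
it. In the first case the edge ends strands of the split skeleton, in the second it starts them. -/
theorem corner_of_nonAlt (m : Marker) {d : Dart X} (h : D.NonAlt d) :
    (corner m d = d ∧ corner m (D.opp d) = D.opp d) ∨
      (corner m d = D.faceNext (D.opp d) ∧ corner m (D.opp d) = D.faceNext d ∧
        quadrant d = m) := by
  have h1 : quadrant d = quadrant (D.opp d) := quadrant_eq_iff.2 h
  by_cases hd : quadrant d = m
  · refine Or.inr ⟨?_, ?_, hd⟩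
    · rw [corner, if_pos hd, faceNext, D.opp_opp]
    · rw [corner, if_pos (h1 ▸ hd), faceNext]
  · exact Or.inl ⟨corner_of_quadrant_ne hd, corner_of_quadrant_ne (h1 ▸ hd)⟩

/-- The curves of the skeleton run along the state circles that contain a non-alternating edge. -/
theorem exists_first_iff [Finite X] {m : Marker} {q : Dart X} (hq : quadrant q ≠ m) :
    (∃ a, D.IsFirst m a ∧ D.InAngle a q) ↔
      ∃ d, D.NonAlt d ∧ D.stateCircle (extremeState X m) d = D.stateCircle _ q := by
  constructor
  · rintro ⟨a, ha, n, rfl, hn⟩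
    refine ⟨a, ((D.isFirst_iff m a).1 ha).1, ?_⟩
    -- Within an angle, moving on to the next corner of the region is moving along the state circle.
    have step : ∀ e, quadrant (D.faceNext e) ≠ m →
        D.stateCircle (extremeState X m) (D.faceNext e) = D.stateCircle _ e := by
      intro e he
      have h1 := D.stateCircle_splitMate (extremeState X m) (D.faceNext e)
      rw [splitMate, if_neg (by exact he), rot_faceNext, D.stateCircle_opp] at h1
      exact h1.symm
    clear hq
    induction n with
    | zero =>
      exact (step a (D.quadrant_of_inAngle ha (D.inAngle_faceNext a))).symm
    | succ n ih =>
      have hq := D.quadrant_of_inAngle ha ⟨n + 1, rfl, hn⟩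
      rw [Function.iterate_succ_apply'] at hq ⊢
      rw [step _ hq]
      exact ih fun k hk => hn k (by omega)
  · rintro ⟨d, hd, hdq⟩
    -- Conversely, both corners next to a non-alternating edge lie in suitable angles, and
    -- alternating edges carry this property along the circle (`hstep`).
    have hnon : ∀ e, D.NonAlt e → ∃ a, D.IsFirst m a ∧ D.InAngle a (corner m e) := by
      intro e he
      rcases D.corner_of_nonAlt m he with ⟨h1, -⟩ | ⟨h1, -, h2⟩
      · rw [h1]
        exact D.exists_first_inAngle he (h1 ▸ quadrant_corner m e)
      · rw [h1]
        exact ⟨D.opp e, D.isFirst_opp ((D.isFirst_iff m e).2 ⟨he, h2⟩), D.inAngle_faceNext _⟩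
    have hstep : ∀ {e}, ¬ D.NonAlt e → ((∃ a, D.IsFirst m a ∧ D.InAngle a (D.faceNext e)) ↔
        ∃ a, D.IsFirst m a ∧ D.InAngle a e) := by
      intro e he
      constructor
      · rintro ⟨a, ha, hae⟩
        rcases D.inAngle_cases hae with h | ⟨q', h1, h2, h3⟩
        · exact absurd (D.faceNext_injective h ▸ ((D.isFirst_iff m a).1 ha).1) he
        · exact ⟨a, ha, D.faceNext_injective h3 ▸ h1⟩
      · rintro ⟨a, ha, hae⟩
        exact ⟨a, ha, D.inAngle_succ hae he⟩
    have key := D.stateCircle_induction (fun e => ∃ a, D.IsFirst m a ∧ D.InAngle a (corner m e))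
      hdq (fun e _ => ?_) (fun e => by
        change (∃ a, D.IsFirst m a ∧ D.InAngle a (corner m (splitMate m e))) = _
        rw [corner_splitMate])
    · have h1 := key.mp (hnon d hd)
      rwa [corner_of_quadrant_ne hq] at h1
    · by_cases he : D.NonAlt e
      · exact propext ⟨fun _ => hnon e he, fun _ => hnon _ (D.nonAlt_opp he)⟩
      · rcases D.corner_opp_of_alt m he with ⟨h1, h2⟩ | ⟨h1, h2⟩
        · rw [h2]; exact propext (hstep h1)
        · rw [h2]; exact propext (hstep h1).symm

/-- A state circle passes through regions in one component of the skeleton. -/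
theorem skeletonConnected_of_stateCircle {m : Marker} {q q' : Dart X} (hq : quadrant q ≠ m)
    (hq' : quadrant q' ≠ m)
    (h : D.stateCircle (extremeState X m) q = D.stateCircle (extremeState X m) q') :
    D.SkeletonConnected (D.face q) (D.face q') := by
  -- The circle changes its region only along edges of the skeleton.
  have key := D.stateCircle_induction (fun e => Quot.mk
    (fun F F' : D.Face => ∃ d, D.NonAlt d ∧ D.face d = F ∧ D.face (D.opp d) = F')
    (D.face (corner m e))) h (fun e _ => ?_) (fun e => by
      change Quot.mk _ (D.face (corner m (splitMate m e))) = _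
      rw [corner_splitMate])
  · have h1 := Quot.eqvGen_exact key
    rwa [corner_of_quadrant_ne hq, corner_of_quadrant_ne hq'] at h1
  · by_cases he : D.NonAlt e
    · rcases D.corner_of_nonAlt m he with ⟨h1, h2⟩ | ⟨h1, h2, -⟩
      · rw [h1, h2]
        exact (Quot.sound ⟨e, he, rfl, rfl⟩).symm
      · rw [h1, h2, D.face_faceNext, D.face_faceNext]
        exact Quot.sound ⟨e, he, rfl, rfl⟩
    · rcases D.corner_opp_of_alt m he with ⟨-, h2⟩ | ⟨-, h2⟩
      · rw [h2, D.face_faceNext]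
      · rw [h2, D.face_faceNext]

/-- A state circle of alternating edges runs round one region. -/
theorem face_eq_of_alternating {m : Marker} {q q' : Dart X} (hq : quadrant q ≠ m)
    (hq' : quadrant q' ≠ m)
    (h : D.stateCircle (extremeState X m) q = D.stateCircle (extremeState X m) q')
    (halt : ¬ ∃ d, D.NonAlt d ∧ D.stateCircle (extremeState X m) d = D.stateCircle _ q) :
    D.face q = D.face q' := by
  have key := D.stateCircle_induction (fun e => D.face (corner m e)) h (fun e he => ?_)
    (fun e => by
      change D.face (corner m (splitMate m e)) = _
      rw [corner_splitMate])
  · rwa [corner_of_quadrant_ne hq, corner_of_quadrant_ne hq'] at key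
  · rcases D.corner_opp_of_alt m (fun h1 => halt ⟨e, h1, he⟩) with ⟨-, h2⟩ | ⟨-, h2⟩
    · rw [h2, D.face_faceNext]
    · rw [h2, D.face_faceNext]

theorem stateCircle_sideDart {m : Marker} {q : Dart X} (hq : quadrant q ≠ m) (b : Bool) :
    D.stateCircle (extremeState X m) (sideDart q b) = D.stateCircle (extremeState X m) q := by
  cases b
  · have h1 := D.stateCircle_splitMate (extremeState X m) q
    rwa [splitMate, if_neg (by exact hq)] at h1
  · rfl

theorem corner_sideDart {m : Marker} {q : Dart X} (hq : quadrant q ≠ m) (b : Bool) :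
    corner m (sideDart q b) = q := by
  cases b
  · exact corner_rot hq
  · exact corner_of_quadrant_ne hq

theorem exists_sideDart_corner (m : Marker) (d : Dart X) : ∃ b, sideDart (corner m d) b = d := by
  unfold corner
  split_ifs
  · exact ⟨false, rot_rotInv d⟩
  · exact ⟨true, rfl⟩

theorem skeletonCurves_seg [Finite X] {m : Marker} {p p' : (D.skeletonCurves m).Pt} {b b' : Bool}
    (h : (D.skeletonCurves m).seg (p, b) (p', b')) :
    sideDart p'.1.2 b' = D.opp (sideDart p.1.2 b) := by
  rcases h with ⟨h1, h2, h3, h4, h5⟩ | ⟨h1, h2, h3, h4, h5⟩ | ⟨h1, h2, h3, h4⟩ |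
    ⟨h1, h2, h3, h4, h5⟩ <;> dsimp only at * <;> subst h1 h2 <;>
    simp only [sideDart, if_true, Bool.false_eq_true, if_false]
  · rw [h5, rot_faceNext]
  · rw [h5, rot_faceNext, D.opp_opp]
  · exact h4
  · rw [h3, h4, rot_faceNext, rot_faceNext, h5]

theorem quadrant_skeletonPt [Finite X] {m : Marker} (p : (D.skeletonCurves m).Pt) :
    quadrant p.1.2 ≠ m :=
  D.quadrant_of_inAngle p.2.1 p.2.2

/-- A segment starts on each side of each point, and its other end is determined by the condition on
the right, so uniqueness gives the converse. -/
theorem skeletonCurves_seg_iff [Finite X] {m : Marker} {p p' : (D.skeletonCurves m).Pt}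
    {b b' : Bool} : (D.skeletonCurves m).seg (p, b) (p', b') ↔
      sideDart p'.1.2 b' = D.opp (sideDart p.1.2 b) := by
  refine ⟨D.skeletonCurves_seg, fun h => ?_⟩
  obtain ⟨⟨r, c⟩, hr, -⟩ := (D.skeletonCurves m).seg_existsUnique (p, b)
  have h1 := D.skeletonCurves_seg hr
  rw [← h] at h1
  have h2 : r.1.2 = p'.1.2 := by
    rw [← corner_sideDart (D.quadrant_skeletonPt r) c, h1,
      corner_sideDart (D.quadrant_skeletonPt p') b']
  obtain rfl : r = p' := (D.skeletonCurves m).arc_injective h2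
  have h3 : c = b' := by
    have hne : rot r.1.2 ≠ r.1.2 := fun h4 => by
      have := isOver_rot r.1.2
      rw [h4] at this
      tauto
    revert h1
    cases c <;> cases b' <;> simp [sideDart, hne, hne.symm]
  rwa [← h3]

theorem skeletonCurves_isotopic [Finite X] (m : Marker) :
    (D.skeletonCurves m).Isotopic (D.nonAltStateCurves m) := by
  let f : (D.skeletonCurves m).Pt → (D.nonAltStateCurves m).Pt := fun p =>
    ⟨p.1.2, D.quadrant_skeletonPt p,
      (D.exists_first_iff (D.quadrant_skeletonPt p)).1 ⟨p.1.1, p.2⟩⟩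
  have hf : Function.Bijective f := by
    constructor
    · intro p p' h
      exact (D.skeletonCurves m).arc_injective (congrArg Subtype.val h)
    · rintro ⟨q, hq, h⟩
      obtain ⟨a, ha⟩ := (D.exists_first_iff hq).2 h
      exact ⟨⟨(a, q), ha⟩, rfl⟩
  exact ⟨Equiv.ofBijective f hf, fun p => rfl, fun p b p' b' => D.skeletonCurves_seg_iff⟩

theorem existsUnique_skeletonPt [Finite X] {m : Marker} {q : Dart X} (hq : quadrant q ≠ m)
    (h : D.IsSkeletonVertex (D.face q)) :
    ∃! p : (D.skeletonCurves m).Pt, (D.skeletonCurves m).arc p = q := by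
  obtain ⟨a, ha⟩ := D.exists_first_of_vertex hq h
  exact ⟨⟨(a, q), ha⟩, rfl, fun p hp => (D.skeletonCurves m).arc_injective hp⟩

/-! ### Curves along state circles -/

namespace CurveSystem

variable {D} (S : CurveSystem D)

/-- The curves of the system follow circles of the extreme state with label `m`. -/
def Follows (m : Marker) : Prop := (∀ p, quadrant (S.arc p) ≠ m) ∧ ∀ p b p' b',
  S.seg (p, b) (p', b') ↔ sideDart (S.arc p') b' = D.opp (sideDart (S.arc p) b)

variable {S} {m : Marker}

/-- A system that meets a state circle contains all of it, because its curves are closed. -/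
theorem Follows.exists_arc (hS : S.Follows m) {p : S.Pt} {q : Dart X} (hq : quadrant q ≠ m)
    {b b' : Bool} (h : sideDart q b' = D.opp (sideDart (S.arc p) b)) : ∃ p', S.arc p' = q := by
  obtain ⟨⟨r, c⟩, hr, -⟩ := S.seg_existsUnique (p, b)
  rw [hS.2, ← h] at hr
  exact ⟨r, by rw [← corner_sideDart (hS.1 r) c, hr, corner_sideDart hq]⟩

theorem Follows.eqvGen_iff (hS : S.Follows m) (A : Dart X → Prop) (p p' : S.Pt) :
    Relation.EqvGen (fun p p' => (A (S.arc p) ∧ A (S.arc p')) ∧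
      ∃ b b', S.seg (p, b) (p', b')) p p' ↔
    Relation.EqvGen (fun q q' => (quadrant q ≠ m ∧ quadrant q' ≠ m) ∧ (A q ∧ A q') ∧
      ∃ b b', sideDart q' b' = D.opp (sideDart q b)) (S.arc p) (S.arc p') := by
  classical
  constructor
  · refine Relation.EqvGen.map S.arc ?_
    rintro r r' ⟨hA, b, b', h⟩
    exact Relation.EqvGen.rel _ _ ⟨⟨hS.1 r, hS.1 r'⟩, hA, b, b', (hS.2 _ _ _ _).1 h⟩
  · intro h
    -- A left inverse of `arc`, with the arbitrary value `p` on the quadrants that the system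
    -- misses. No segment joins a quadrant that is met to one that is missed, so `f` carries steps
    -- to steps or to constants.
    let f : Dart X → S.Pt := fun q => if h : ∃ r, S.arc r = q then h.choose else p
    have hf : ∀ r, f (S.arc r) = r := fun r => by
      have hex : ∃ r', S.arc r' = S.arc r := ⟨r, rfl⟩
      have h1 : f (S.arc r) = hex.choose := dif_pos hex
      exact h1.trans (S.arc_injective hex.choose_spec)
    rw [← hf p, ← hf p']
    refine Relation.EqvGen.map f ?_ h
    rintro q q' ⟨⟨hq, hq'⟩, hA, b, b', hs⟩
    by_cases hr : ∃ r, S.arc r = q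
    · obtain ⟨r, rfl⟩ := hr
      obtain ⟨r', rfl⟩ := hS.exists_arc hq' hs
      rw [hf, hf]
      exact Relation.EqvGen.rel _ _ ⟨hA, b, b', (hS.2 _ _ _ _).2 hs⟩
    · have hr' : ¬ ∃ r, S.arc r = q' := by
        rintro ⟨r', rfl⟩
        exact hr (hS.exists_arc hq (b := b') (b' := b) (by rw [hs, D.opp_opp]))
      have h1 : f q = p := dif_neg hr
      have h2 : f q' = p := dif_neg hr'
      rw [h1, h2]
      exact Relation.EqvGen.refl _

theorem Follows.circle_eq_iff (hS : S.Follows m) (p p' : S.Pt) :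
    S.circle p = S.circle p' ↔
      D.stateCircle (extremeState X m) (S.arc p) = D.stateCircle _ (S.arc p') := by
  have h0 := hS.eqvGen_iff (fun _ => True) p p'
  simp only [true_and, and_true] at h0
  have h1 : S.circle p = S.circle p' ↔
      Relation.EqvGen (fun p p' => ∃ b b', S.seg (p, b) (p', b')) p p' :=
    ⟨fun h => Quot.eqvGen_exact h, fun h => Quot.eqvGen_sound h⟩
  rw [h1, h0]
  constructor
  · intro h
    generalize S.arc p = q at h
    generalize S.arc p' = q' at h
    clear h0 h1
    induction h with
    | rel q q' h =>
      obtain ⟨⟨hq, hq'⟩, b, b', h⟩ := h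
      rw [← D.stateCircle_sideDart hq b, ← D.stateCircle_sideDart hq' b', h, D.stateCircle_opp]
    | refl a => rfl
    | symm a b _ ih => exact ih.symm
    | trans a b c _ _ ih1 ih2 => exact ih1.trans ih2
  · intro h
    have key := D.stateCircle_induction (fun e => Quot.mk
      (fun q q' : Dart X => (quadrant q ≠ m ∧ quadrant q' ≠ m) ∧
        ∃ b b', sideDart q' b' = D.opp (sideDart q b)) (corner m e)) h (fun e _ => ?_)
      (fun e => by
        change Quot.mk _ (corner m (splitMate m e)) = _
        rw [corner_splitMate])
    · rw [corner_of_quadrant_ne (hS.1 p), corner_of_quadrant_ne (hS.1 p')] at key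
      exact Quot.eqvGen_exact key
    · obtain ⟨b, hb⟩ := exists_sideDart_corner m e
      obtain ⟨b', hb'⟩ := exists_sideDart_corner m (D.opp e)
      exact (Quot.sound ⟨⟨quadrant_corner _ _, quadrant_corner _ _⟩, b, b', by rw [hb, hb']⟩).symm

/-- By `hex` the curves cross both radial arcs of the chord, so the condition on all ends in
`chordsOn` really speaks of two ends. -/
theorem Follows.mem_crossChords (hS : S.Follows m) {c : X} (hc : c ∈ S.chords)
    (hex : ∀ q : Dart X, q.1 = c → quadrant q ≠ m → ∃ p, S.arc p = q) :
    c ∈ S.crossChords ↔ ∀ q q' : Dart X, q.1 = c → q'.1 = c → quadrant q ≠ m → quadrant q' ≠ m →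
      D.stateCircle (extremeState X m) q = D.stateCircle (extremeState X m) q' := by
  constructor
  · rintro ⟨γ, -, hγ⟩ q q' hqc hqc' hq hq'
    obtain ⟨p, rfl⟩ := hex q hqc hq
    obtain ⟨p', rfl⟩ := hex q' hqc' hq'
    rw [← hS.circle_eq_iff, hγ p ⟨hc, hqc⟩, hγ p' ⟨hc, hqc'⟩]
  · intro h
    obtain ⟨p, hp⟩ := hex (corner m (c, 0)) (corner_fst _ _) (quadrant_corner _ _)
    have hpc : (S.arc p).1 = c := by rw [hp, corner_fst]
    refine ⟨S.circle p, ⟨p, hc, hpc⟩, fun p' hp' => ?_⟩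
    rw [hS.circle_eq_iff]
    exact h _ _ hp'.2 hpc (hS.1 _) (hS.1 _)

end CurveSystem

/-! ### Chords with both ends on one circle. -/

theorem stateCurves_follows (m : Marker) : (D.stateCurves m).Follows m :=
  ⟨fun p => p.2.1, fun _ _ _ _ => Iff.rfl⟩

theorem skeletonCurves_follows [Finite X] (m : Marker) : (D.skeletonCurves m).Follows m :=
  ⟨D.quadrant_skeletonPt, fun _ _ _ _ => D.skeletonCurves_seg_iff⟩

/-- The two quadrants at a crossing that an `m`-chord meets lie on the same state circle. -/
def IsSelfChord (m : Marker) (c : X) : Prop :=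
  ∀ q q' : Dart X, q.1 = c → q'.1 = c → quadrant q ≠ m → quadrant q' ≠ m →
    D.stateCircle (extremeState X m) q = D.stateCircle (extremeState X m) q'

theorem mem_crossChords_stateCurves {m : Marker} {c : X} :
    c ∈ (D.stateCurves m).crossChords ↔ D.IsSelfChord m c :=
  (D.stateCurves_follows m).mem_crossChords (Set.mem_univ c) fun q _ hq => ⟨⟨q, hq, trivial⟩, rfl⟩

theorem exists_skeletonPt [Finite X] {m : Marker} {c : X} (h : D.IsSkeletonArc m c) (q : Dart X)
    (hqc : q.1 = c) (hq : quadrant q ≠ m) :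
    ∃ p : (D.skeletonCurves m).Pt, (D.skeletonCurves m).arc p = q :=
  (D.existsUnique_skeletonPt hq (h q q hqc hqc hq hq).1).exists

theorem isSkeletonArc_of_isSelfChord [Fintype X] (hplanar : D.Planar) (hnonsplit : D.NonSplit)
    (hreduced : D.Reduced) {m : Marker} {c : X} (h : D.IsSelfChord m c) : D.IsSkeletonArc m c := by
  have hopp : ∀ q : Dart X, quadrant q ≠ m → quadrant (rot (rot q)) ≠ m := by
    intro q hq
    rwa [ne_eq, quadrant_eq_iff.2 (show IsOver (rot (rot q)) ↔ IsOver q by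
      rw [isOver_rot, isOver_rot, not_not])]
  intro q q' hqc hqc' hq hq'
  refine ⟨?_, D.skeletonConnected_of_stateCircle hq hq' (h q q' hqc hqc' hq hq')⟩
  have hne := D.face_ne_of_reduced hplanar hnonsplit hreduced q
  have hcirc := h q (rot (rot q)) hqc hqc hq (hopp q hq)
  by_contra hv
  refine hne (D.face_eq_of_alternating hq (hopp q hq) hcirc fun hex => hv ?_).symm
  obtain ⟨a, ha, haq⟩ := (D.exists_first_iff hq).2 hex
  exact ⟨a, ((D.isFirst_iff m a).1 ha).1, (D.face_of_inAngle haq).symm⟩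

theorem mem_crossChords_skeletonCurves [Fintype X] (hplanar : D.Planar) (hnonsplit : D.NonSplit)
    (hreduced : D.Reduced) {m : Marker} {c : X} :
    c ∈ (D.skeletonCurves m).crossChords ↔ D.IsSelfChord m c := by
  constructor
  · intro h
    obtain ⟨γ, ⟨p, hp⟩, hγ⟩ := h
    have hc : D.IsSkeletonArc m c := hp.1
    exact ((D.skeletonCurves_follows m).mem_crossChords hc (D.exists_skeletonPt hc)).1
      ⟨γ, ⟨p, hp⟩, hγ⟩
  · intro h
    have hc := D.isSkeletonArc_of_isSelfChord hplanar hnonsplit hreduced h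
    exact ((D.skeletonCurves_follows m).mem_crossChords hc (D.exists_skeletonPt hc)).2 h

end LinkDiagram

/-! ### Sums over independent sets -/

section IndependentSets

open Classical in
/-- The signed indicator function of the sets in which any two elements are related by `P`. -/
noncomputable def pairwiseSign {V : Type*} (P : V → V → Prop) (T : Finset V) : ℤ :=
  if ∀ c ∈ T, ∀ d ∈ T, c ≠ d → P c d then (-1) ^ T.card else 0

theorem pairwiseSign_union {V : Type*} [DecidableEq V] {P : V → V → Prop} {S T : Finset V}
    (hST : Disjoint S T) (h : ∀ c ∈ S, ∀ d ∈ T, P c d ∧ P d c) :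
    pairwiseSign P (S ∪ T) = pairwiseSign P S * pairwiseSign P T := by
  classical
  have hiff : (∀ c ∈ S ∪ T, ∀ d ∈ S ∪ T, c ≠ d → P c d) ↔
      (∀ c ∈ S, ∀ d ∈ S, c ≠ d → P c d) ∧ ∀ c ∈ T, ∀ d ∈ T, c ≠ d → P c d := by
    constructor
    · intro H
      exact ⟨fun c hc d hd => H c (Finset.mem_union_left _ hc) d (Finset.mem_union_left _ hd),
        fun c hc d hd => H c (Finset.mem_union_right _ hc) d (Finset.mem_union_right _ hd)⟩
    · rintro ⟨H1, H2⟩ c hc d hd hcd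
      rcases Finset.mem_union.1 hc with hc | hc <;> rcases Finset.mem_union.1 hd with hd | hd
      · exact H1 c hc d hd hcd
      · exact (h c hc d hd).1
      · exact (h d hd c hc).2
      · exact H2 c hc d hd hcd
  unfold pairwiseSign
  by_cases h1 : ∀ c ∈ S, ∀ d ∈ S, c ≠ d → P c d
  · by_cases h2 : ∀ c ∈ T, ∀ d ∈ T, c ≠ d → P c d
    · rw [if_pos (hiff.2 ⟨h1, h2⟩), if_pos h1, if_pos h2, Finset.card_union_of_disjoint hST, pow_add]
    · rw [if_neg (fun H => h2 (hiff.1 H).2), if_neg h2, mul_zero]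
  · rw [if_neg (fun H => h1 (hiff.1 H).1), if_neg h1, zero_mul]

theorem sum_powerset_pairwiseSign_union {V : Type*} [DecidableEq V] {P : V → V → Prop}
    {A B : Finset V} (hAB : Disjoint A B) (h : ∀ c ∈ A, ∀ d ∈ B, P c d ∧ P d c) :
    ∑ T ∈ (A ∪ B).powerset, pairwiseSign P T =
      (∑ T ∈ A.powerset, pairwiseSign P T) * ∑ T ∈ B.powerset, pairwiseSign P T := by
  rw [Finset.sum_mul_sum, ← Finset.sum_product']
  refine Finset.sum_nbij' (fun T => (T ∩ A, T ∩ B)) (fun T => T.1 ∪ T.2) ?_ ?_ ?_ ?_ ?_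
  · intro T _
    simp [Finset.inter_subset_right]
  · rintro ⟨T, T'⟩ hT
    rw [Finset.mem_product, Finset.mem_powerset, Finset.mem_powerset] at hT
    exact Finset.mem_powerset.2 (Finset.union_subset_union hT.1 hT.2)
  · intro T hT
    dsimp only
    rw [← Finset.inter_union_distrib_left, Finset.inter_eq_left.2 (Finset.mem_powerset.1 hT)]
  · rintro ⟨T, T'⟩ hT
    rw [Finset.mem_product, Finset.mem_powerset, Finset.mem_powerset] at hT
    have h1 : Disjoint T B := hAB.mono_left hT.1
    have h2 : Disjoint T' A := (hAB.mono_right hT.2).symm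
    dsimp only
    rw [Finset.union_inter_distrib_right, Finset.union_inter_distrib_right,
      Finset.inter_eq_left.2 hT.1, Finset.inter_eq_left.2 hT.2,
      Finset.disjoint_iff_inter_eq_empty.1 h1, Finset.disjoint_iff_inter_eq_empty.1 h2,
      Finset.union_empty, Finset.empty_union]
  · intro T hT
    dsimp only
    rw [← pairwiseSign_union (hAB.mono Finset.inter_subset_right Finset.inter_subset_right)
      fun c hc d hd => h c (Finset.mem_of_mem_inter_right hc) d (Finset.mem_of_mem_inter_right hd),
      ← Finset.inter_union_distrib_left, Finset.inter_eq_left.2 (Finset.mem_powerset.1 hT)]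

theorem prod_sum_pairwiseSign {V Γ : Type*} [DecidableEq V] {P : V → V → Prop} (A : Γ → Finset V)
    (hA : ∀ γ γ', γ ≠ γ' → Disjoint (A γ) (A γ'))
    (h : ∀ γ γ', γ ≠ γ' → ∀ c ∈ A γ, ∀ d ∈ A γ', P c d) (s : Finset Γ) :
    ∏ γ ∈ s, ∑ T ∈ (A γ).powerset, pairwiseSign P T =
      ∑ T ∈ (s.biUnion A).powerset, pairwiseSign P T := by
  classical
  induction s using Finset.induction_on with
  | empty => simp [pairwiseSign]
  | insert γ s hγ ih =>
    have hne : ∀ γ' ∈ s, γ ≠ γ' := fun γ' h1 h2 => hγ (h2 ▸ h1)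
    rw [Finset.prod_insert hγ, ih, Finset.biUnion_insert, sum_powerset_pairwiseSign_union]
    · exact (Finset.disjoint_biUnion_right _ _ _).2 fun γ' h1 => hA _ _ (hne γ' h1)
    · intro c hc d hd
      obtain ⟨γ', h1, h2⟩ := Finset.mem_biUnion.1 hd
      exact ⟨h _ _ (hne γ' h1) c hc d h2, h _ _ (hne γ' h1).symm d h2 c hc⟩

theorem indepSum_eq {V : Type*} [DecidableEq V] (A : Finset V) (B : Set V) [Fintype B]
    (hAB : ∀ c, c ∈ A ↔ c ∈ B) {P : V → V → Prop} (G : SimpleGraph B)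
    (hG : ∀ c d : B, ¬ G.Adj c d ↔ (c ≠ d → P c d ∧ P d c)) :
    LinkDiagram.indepSum G = ∑ T ∈ A.powerset, pairwiseSign P T := by
  classical
  unfold LinkDiagram.indepSum
  rw [Finset.sum_filter]
  refine Finset.sum_nbij' (fun C => C.map (Function.Embedding.subtype _))
    (fun T => T.subtype (· ∈ B)) ?_ ?_ ?_ ?_ ?_
  · intro C _
    rw [Finset.mem_powerset]
    intro c hc
    obtain ⟨d, -, rfl⟩ := Finset.mem_map.1 hc
    exact (hAB _).2 d.2
  · intro T _
    exact Finset.mem_univ _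
  · intro C _
    ext c
    simp
  · intro T hT
    rw [Finset.subtype_map, Finset.filter_true_of_mem]
    exact fun c hc => (hAB c).1 (Finset.mem_powerset.1 hT hc)
  · intro C _
    unfold pairwiseSign
    rw [Finset.card_map]
    suffices H : G.IsIndepSet (C : Set B) ↔ ∀ c ∈ C.map (Function.Embedding.subtype _),
        ∀ d ∈ C.map (Function.Embedding.subtype _), c ≠ d → P c d by
      by_cases h : G.IsIndepSet (C : Set B)
      · rw [if_pos h, if_pos (H.1 h)]
      · rw [if_neg h, if_neg (fun h1 => h (H.2 h1))]
    constructor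
    · intro H c hc d hd hcd
      obtain ⟨c, hc', rfl⟩ := Finset.mem_map.1 hc
      obtain ⟨d, hd', rfl⟩ := Finset.mem_map.1 hd
      have hne : c ≠ d := fun h => hcd (by rw [h])
      exact ((hG c d).1 (H hc' hd' hne) hne).1
    · intro H c hc d hd hcd
      refine (hG c d).2 fun _ => ?_
      have h1 : (c : V) ≠ d := fun h => hcd (Subtype.ext h)
      have h2 : ∀ {e : B}, e ∈ (C : Set B) → (e : V) ∈ C.map (Function.Embedding.subtype _) :=
        fun he => Finset.mem_map_of_mem (Function.Embedding.subtype _) he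
      exact ⟨H _ (h2 hc) _ (h2 hd) h1, H _ (h2 hd) _ (h2 hc) h1.symm⟩

end IndependentSets

/-! ### Extreme coefficients of powers -/

section Coefficients

open LaurentPolynomial

theorem T_mul_pow_succ (e : ℤ) (j : ℕ) :
    (T e * (-T 2 - T (-2)) ^ (j + 1) : ℤ[T;T⁻¹]) =
      -(T (e + 2) * (-T 2 - T (-2)) ^ j) - T (e - 2) * (-T 2 - T (-2)) ^ j := by
  rw [T_add, T_sub]
  ring

theorem coeff_T_mul_pow_of_le (j : ℕ) : ∀ e n : ℤ, e + 2 * j ≤ n →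
    (T e * (-T 2 - T (-2)) ^ j : ℤ[T;T⁻¹]).coeff n = if e + 2 * j = n then (-1) ^ j else 0 := by
  induction j with
  | zero => intro e n _; simp
  | succ j ih =>
    intro e n h
    push_cast at h ⊢
    rw [T_mul_pow_succ, AddMonoidAlgebra.coeff_sub, AddMonoidAlgebra.coeff_neg,
      Finsupp.sub_apply, Finsupp.neg_apply, ih _ _ (by omega), ih _ _ (by omega),
      if_neg (show ¬ e - 2 + 2 * (j : ℤ) = n by omega)]
    by_cases he : e + 2 * ((j : ℤ) + 1) = n
    · rw [if_pos he, if_pos (by omega), pow_succ]; ring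
    · rw [if_neg he, if_neg (by omega)]; simp

theorem coeff_T_mul_pow_of_ge (j : ℕ) : ∀ e n : ℤ, n ≤ e - 2 * j →
    (T e * (-T 2 - T (-2)) ^ j : ℤ[T;T⁻¹]).coeff n = if e - 2 * j = n then (-1) ^ j else 0 := by
  induction j with
  | zero => intro e n _; simp
  | succ j ih =>
    intro e n h
    push_cast at h ⊢
    rw [T_mul_pow_succ, AddMonoidAlgebra.coeff_sub, AddMonoidAlgebra.coeff_neg,
      Finsupp.sub_apply, Finsupp.neg_apply, ih _ _ (by omega), ih _ _ (by omega),
      if_neg (show ¬ e + 2 - 2 * (j : ℤ) = n by omega)]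
    by_cases he : e - 2 * ((j : ℤ) + 1) = n
    · rw [if_pos he, if_pos (by omega), pow_succ]; ring
    · rw [if_neg he, if_neg (by omega)]; simp

end Coefficients

/-! ### The extreme coefficients of the bracket polynomial -/

namespace LinkDiagram

variable {X : Type u} (D : LinkDiagram X)

theorem circleCount_pos [Finite X] (hX : Nonempty X) (s : X → Marker) : 0 < D.circleCount s := by
  obtain ⟨c⟩ := hX
  have : Finite (D.StateCircle s) := Finite.of_surjective (D.stateCircle s) Quot.mk_surjective
  have : Nonempty (D.StateCircle s) := ⟨D.stateCircle s (c, 0)⟩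
  exact Nat.card_pos

variable [DecidableEq X]

/-- The other label. -/
def otherMarker : Marker → Marker
  | Marker.A => Marker.B
  | Marker.B => Marker.A

theorem otherMarker_ne (m : Marker) : otherMarker m ≠ m := by cases m <;> simp [otherMarker]

/-- The state which differs from the extreme state with label `m` at the crossings in `T`. -/
def flipState (m : Marker) (T : Finset X) : X → Marker :=
  fun c => if c ∈ T then otherMarker m else m

theorem flipState_empty (m : Marker) : flipState m (∅ : Finset X) = extremeState X m := by
  funext c; simp [flipState, extremeState]

namespace Checkerboard

variable {D} (K : D.Checkerboard)

theorem perm_flipState_insert (m : Marker) (T : Finset X) (c : X) (hc : c ∉ T) :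
    K.perm (flipState m (insert c T)) =
      Equiv.swap (K.exit (c, 0)) (K.exit (rot (rot (c, 0)))) * K.perm (flipState m T) := by
  apply K.perm_flip
  · simp [flipState, hc, (otherMarker_ne m).symm]
  · intro c' h
    simp [flipState, h]

/-- The chord at `c` does not separate the ends of the chord at `d`. -/
def Unlinked (m : Marker) (c d : X) : Prop :=
  (K.perm (flipState m {c})).SameCycle (K.exit (d, 0)) (K.exit (rot (rot (d, 0))))

theorem isSelfChord_iff {m : Marker} {c : X} : D.IsSelfChord m c ↔
    (K.perm (flipState m ∅)).SameCycle (K.exit (c, 0)) (K.exit (rot (rot (c, 0)))) := by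
  rw [flipState_empty, ← K.stateCircle_eq_iff]
  constructor
  · intro h
    have h1 := h (corner m (K.exit (c, 0)).1) (corner m (K.exit (rot (rot (c, 0)))).1)
      (by rw [corner_fst, exit_fst]) (by rw [corner_fst, exit_fst]; rfl) (quadrant_corner _ _)
      (quadrant_corner _ _)
    rwa [stateCircle_corner, stateCircle_corner] at h1
  · intro h q q' hqc hqc' hq hq'
    have key : ∀ q : Dart X, q.1 = c → quadrant q ≠ m →
        D.stateCircle (extremeState X m) q = D.stateCircle _ (K.exit (c, 0)).1 := by
      intro q hqc hq
      rw [← K.corner_exit hq, stateCircle_corner]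
      rcases K.eq_exit_or (c, 0) (K.exit q) (by rw [exit_fst, hqc]) with h1 | h1
      · rw [h1]
      · rw [h1, h]
    rw [key q hqc hq, key q' hqc' hq']

end Checkerboard

variable [Fintype X]

theorem flipState_bijective (m : Marker) : Function.Bijective (flipState (X := X) m) := by
  constructor
  · intro S T h
    ext c
    have h1 := congrFun h c
    have h2 := otherMarker_ne m
    unfold flipState at h1
    by_cases hS : c ∈ S <;> by_cases hT : c ∈ T <;> simp_all [Ne.symm h2]
  · intro s
    refine ⟨Finset.univ.filter fun c => s c ≠ m, ?_⟩
    funext c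
    unfold flipState
    simp only [Finset.mem_filter, Finset.mem_univ, true_and]
    generalize s c = x
    cases x <;> cases m <;> simp [otherMarker]

theorem labelCount_other (m : Marker) (T : Finset X) :
    labelCount (otherMarker m) (flipState m T) = T.card := by
  unfold labelCount flipState
  congr 1
  ext c
  have := otherMarker_ne m
  by_cases hc : c ∈ T <;> simp [hc, this.symm]

theorem labelCount_self (m : Marker) (T : Finset X) :
    labelCount m (flipState m T) + T.card = Fintype.card X := by
  have h : labelCount m (flipState m T) = Tᶜ.card := by
    unfold labelCount flipState
    congr 1
    ext c
    have := otherMarker_ne m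
    by_cases hc : c ∈ T <;> simp [hc, this]
  rw [h, Finset.card_compl_add_card]

theorem extremeCoeff_eq_sum (hX : Nonempty X) {m : Marker}
    (hle : ∀ T, D.circleCount (flipState m T) ≤ D.circleCount (extremeState X m) + T.card) :
    D.extremeCoeff m = (-1) ^ (D.circleCount (extremeState X m) - 1) * ∑ T : Finset X,
      if D.circleCount (flipState m T) = D.circleCount (extremeState X m) + T.card
      then (-1) ^ T.card else 0 := by
  have hpos := D.circleCount_pos hX
  unfold extremeCoeff bracket
  rw [AddMonoidAlgebra.coeff_sum, Finsupp.finsetSum_apply,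
    ← Function.Bijective.sum_comp (flipState_bijective (X := X) m), Finset.mul_sum]
  refine Finset.sum_congr rfl fun T _ => ?_
  have h1 := labelCount_other m T
  have h2 := labelCount_self m T
  have h3 := hpos (flipState m T)
  have h4 := hpos (extremeState X m)
  have h5 := hle T
  have hcast : ((D.circleCount (flipState m T) - 1 : ℕ) : ℤ) = D.circleCount (flipState m T) - 1 := by
    omega
  have hfin : (if D.circleCount (flipState m T) = D.circleCount (extremeState X m) + T.card
      then (-1 : ℤ) ^ (D.circleCount (flipState m T) - 1) else 0) =
      (-1) ^ (D.circleCount (extremeState X m) - 1) *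
        if D.circleCount (flipState m T) = D.circleCount (extremeState X m) + T.card
        then (-1) ^ T.card else 0 := by
    split_ifs with h
    · rw [h, ← pow_add]; congr 1; omega
    · rw [mul_zero]
  rw [← hfin]
  cases m
  · rw [coeff_T_mul_pow_of_le]
    · refine if_congr ?_ rfl rfl
      simp only [extremeDegree, otherMarker, hcast] at *
      omega
    · simp only [extremeDegree, otherMarker, hcast] at *
      omega
  · rw [coeff_T_mul_pow_of_ge]
    · refine if_congr ?_ rfl rfl
      simp only [extremeDegree, otherMarker, hcast] at *
      omega
    · simp only [extremeDegree, otherMarker, hcast] at *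
      omega

namespace Checkerboard

variable {D} (K : D.Checkerboard)

theorem circleCount_flipState_le (K : D.Checkerboard) (m : Marker) (T : Finset X) :
    D.circleCount (flipState m T) ≤ D.circleCount (extremeState X m) + T.card := by
  have h := Equiv.Perm.orbitCount_union_le (σ := fun T => K.perm (flipState m T))
    (fun c => K.exit_ne (c, 0)) (K.perm_flipState_insert m) ∅ T (Finset.disjoint_empty_left T)
  rwa [Finset.empty_union, ← circleCount_eq, ← circleCount_eq, flipState_empty] at h

theorem circleCount_flipState_eq_iff (m : Marker) (T : Finset X) :
    D.circleCount (flipState m T) = D.circleCount (extremeState X m) + T.card ↔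
      (∀ c ∈ T, D.IsSelfChord m c) ∧ ∀ c ∈ T, ∀ d ∈ T, c ≠ d → K.Unlinked m c d := by
  have h := Equiv.Perm.orbitCount_union_eq_iff (σ := fun T => K.perm (flipState m T))
    (fun c => K.exit_ne (c, 0)) (K.perm_flipState_insert m) ∅ T (Finset.disjoint_empty_left T)
  rw [Finset.empty_union, ← circleCount_eq, ← circleCount_eq, flipState_empty] at h
  rw [h]
  simp only [K.isSelfChord_iff, Unlinked, flipState_empty]
  rfl

theorem unlinked_of_ne {m : Marker} {c d : X} (hc : D.IsSelfChord m c) (hd : D.IsSelfChord m d)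
    {q q' : Dart X} (hqc : q.1 = c) (hqd : q'.1 = d) (hq : quadrant q ≠ m) (hq' : quadrant q' ≠ m)
    (h : D.stateCircle (extremeState X m) q' ≠ D.stateCircle (extremeState X m) q) :
    K.Unlinked m c d := by
  unfold Unlinked
  have h1 := K.perm_flipState_insert m ∅ c (Finset.notMem_empty c)
  rw [insert_empty_eq] at h1
  rw [h1]
  refine (K.isSelfChord_iff.1 hc).swap_mul_of_not (K.exit_ne _) (K.isSelfChord_iff.1 hd)
    fun h2 => h ?_
  rw [flipState_empty, ← K.stateCircle_eq_iff, ← stateCircle_corner, ← stateCircle_corner D m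
    (K.exit (c, 0)).1] at h2
  rw [hd q' (corner m (K.exit (d, 0)).1) hqd (by rw [corner_fst, exit_fst]) hq'
    (quadrant_corner _ _), h2]
  exact hc _ _ (by rw [corner_fst, exit_fst]) hqc (quadrant_corner _ _) hq

/-- Interlacing of chord ends along the curves of a system which follows state circles. -/
theorem alternate_iff {S : CurveSystem D} {m : Marker} (hS : S.Follows m) {c d : X} (hcd : d ≠ c)
    (hc : c ∈ S.chords) (hd : d ∈ S.chords) (hself : D.IsSelfChord m c)
    (hex : ∀ q : Dart X, q.1 = d → quadrant q ≠ m → ∃ p, S.arc p = q) :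
    S.Alternate c d ↔ ¬ K.Unlinked m c d := by
  have hjoin : ∀ p p', (S.arc p).1 = d → (S.arc p').1 = d → (S.JoinedAvoiding c p p' ↔
      (K.perm (flipState m {c})).SameCycle (K.exit (S.arc p)) (K.exit (S.arc p'))) := by
    intro p p' hp hp'
    have h1 := hS.eqvGen_iff (fun q => q.1 ≠ c) p p'
    rw [K.joined_iff (s := flipState m {c}) (by simp [flipState, otherMarker_ne])
      (fun c' h => by simp [flipState, h])
      ((K.stateCircle_eq_iff _ _ _).2 (flipState_empty (X := X) m ▸ K.isSelfChord_iff.1 hself))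
      (hS.1 p) (hS.1 p') (by rwa [hp]) (by rwa [hp'])] at h1
    rw [← h1, CurveSystem.JoinedAvoiding]
    simp only [CurveSystem.IsEnd, hc, true_and, and_assoc, ne_eq]
  constructor
  · rintro ⟨p, p', ⟨-, hp⟩, ⟨-, hp'⟩, hpp'⟩ hun
    rw [hjoin p p' hp hp'] at hpp'
    unfold Unlinked at hun
    rcases K.eq_exit_or (d, 0) (K.exit (S.arc p)) (by rw [exit_fst, hp]) with h1 | h1 <;>
      rcases K.eq_exit_or (d, 0) (K.exit (S.arc p')) (by rw [exit_fst, hp']) with h2 | h2 <;>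
      rw [h1, h2] at hpp'
    · exact hpp' (Equiv.Perm.SameCycle.refl _ _)
    · exact hpp' hun
    · exact hpp' hun.symm
    · exact hpp' (Equiv.Perm.SameCycle.refl _ _)
  · intro hun
    obtain ⟨p, hp⟩ := hex (corner m (K.exit (d, 0)).1) (by rw [corner_fst, exit_fst])
      (quadrant_corner _ _)
    obtain ⟨p', hp'⟩ := hex (corner m (K.exit (rot (rot (d, 0)))).1)
      (by rw [corner_fst, exit_fst]; rfl) (quadrant_corner _ _)
    have h1 : (S.arc p).1 = d := by rw [hp, corner_fst, exit_fst]
    have h2 : (S.arc p').1 = d := by rw [hp', corner_fst, exit_fst]; rfl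
    refine ⟨p, p', ⟨hd, h1⟩, ⟨hd, h2⟩, ?_⟩
    rwa [hjoin p p' h1 h2, hp, hp', exit_corner, exit_corner]

end Checkerboard

variable {D}

theorem sum_eq_indepProduct (hplanar : D.Planar) (hnonsplit : D.NonSplit) (hreduced : D.Reduced)
    (K : D.Checkerboard) (m : Marker) :
    (∑ T : Finset X, if D.circleCount (flipState m T) =
        D.circleCount (extremeState X m) + T.card then (-1 : ℤ) ^ T.card else 0) =
      (D.skeletonCurves m).indepProduct := by
  classical
  set S := D.skeletonCurves m with hSdef
  have hS : S.Follows m := D.skeletonCurves_follows m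
  have hcross : ∀ {c}, c ∈ S.crossChords ↔ D.IsSelfChord m c :=
    D.mem_crossChords_skeletonCurves hplanar hnonsplit hreduced
  have : Finite S.Pt := Finite.of_injective S.arc S.arc_injective
  have : Finite S.Circle := Finite.of_surjective S.circle Quot.mk_surjective
  have := Fintype.ofFinite S.Circle
  let A : S.Circle → Finset X := fun γ => Finset.univ.filter fun c => c ∈ S.chordsOn γ
  have hA : ∀ γ c, c ∈ A γ ↔ c ∈ S.chordsOn γ := fun γ c => by simp [A]
  have hself : ∀ {γ c}, c ∈ S.chordsOn γ → D.IsSelfChord m c := fun {γ c} h => hcross.1 ⟨γ, h⟩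
  have harc : ∀ {γ c}, c ∈ S.chordsOn γ → D.IsSkeletonArc m c := fun {γ c} h => by
    obtain ⟨⟨p, hp⟩, -⟩ := h
    exact hp.1
  have hunion : ∀ c, c ∈ Finset.univ.biUnion A ↔ D.IsSelfChord m c := by
    intro c
    rw [← hcross, Finset.mem_biUnion]
    simp only [Finset.mem_univ, true_and, hA]
    rfl
  have hprod : S.indepProduct = ∏ γ, ∑ T ∈ (A γ).powerset, pairwiseSign (K.Unlinked m) T := by
    unfold CurveSystem.indepProduct
    rw [finprod_eq_prod_of_fintype]
    refine Finset.prod_congr rfl fun γ _ => indepSum_eq (A γ) _ (hA γ) _ ?_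
    rintro ⟨c, hc⟩ ⟨d, hd⟩
    by_cases hcd : c = d
    · subst hcd
      simp
    · have h1 := K.alternate_iff hS (Ne.symm hcd) (harc hc) (harc hd) (hself hc)
        (D.exists_skeletonPt (harc hd))
      have h2 := K.alternate_iff hS hcd (harc hd) (harc hc) (hself hd)
        (D.exists_skeletonPt (harc hc))
      unfold CurveSystem.intersectionGraph
      rw [SimpleGraph.fromRel_adj]
      simp only [h1, h2, ne_eq, Subtype.mk.injEq, hcd]
      tauto
  rw [hprod, prod_sum_pairwiseSign A]
  · rw [← Finset.sum_subset (Finset.subset_univ (Finset.univ.biUnion A).powerset)]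
    · refine Finset.sum_congr rfl fun T hT => ?_
      have h := (K.circleCount_flipState_eq_iff m T).trans
        (and_iff_right fun c hc => (hunion c).1 (Finset.mem_powerset.1 hT hc))
      unfold pairwiseSign
      by_cases h1 : D.circleCount (flipState m T) = D.circleCount (extremeState X m) + T.card
      · rw [if_pos h1, if_pos (h.1 h1)]
      · rw [if_neg h1, if_neg (fun h2 => h1 (h.2 h2))]
    · intro T _ hT
      refine if_neg fun h => hT (Finset.mem_powerset.2 fun c hc => (hunion c).2 ?_)
      exact ((K.circleCount_flipState_eq_iff m T).1 h).1 c hc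
  · intro γ γ' hne
    rw [Finset.disjoint_left]
    intro c hc hc'
    obtain ⟨⟨p, hp⟩, h1⟩ := (hA _ _).1 hc
    exact hne ((h1 p hp).symm.trans (((hA _ _).1 hc').2 p hp))
  · intro γ γ' hne c hc d hd
    rw [hA] at hc hd
    obtain ⟨⟨p, hp⟩, h1⟩ := id hc
    obtain ⟨⟨p', hp'⟩, h2⟩ := id hd
    refine K.unlinked_of_ne (hself hc) (hself hd) hp.2 hp'.2 (hS.1 p) (hS.1 p') fun h => hne ?_
    rw [← h1 p hp, ← h2 p' hp', hS.circle_eq_iff, h]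

end LinkDiagram

theorem mainTheorem5 {X : Type*} [Fintype X] [DecidableEq X] (D : LinkDiagram X)
    (hplanar : D.Planar) (hnonsplit : D.NonSplit) (hreduced : D.Reduced) :
    (∀ a, D.NonAlt a → ∃! b, D.SkeletonNext a b) ∧
    (∀ b, D.NonAlt b → ∃! a, D.NonAlt a ∧ D.SkeletonNext a b) ∧
    (∀ a b, D.NonAlt a → D.SkeletonNext a b →
      (D.IsPlus a ∧ D.IsMinus b) ∨ (D.IsMinus a ∧ D.IsPlus b)) ∧
    ∀ m : Marker,
      (D.skeletonCurves m).Isotopic (D.nonAltStateCurves m) ∧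
      (∀ c, D.IsSkeletonArc m c → ∀ q : Dart X, q.1 = c → quadrant q ≠ m →
        ∃! p : (D.skeletonCurves m).Pt, (D.skeletonCurves m).arc p = q) ∧
      (D.stateCurves m).crossChords = (D.skeletonCurves m).crossChords ∧
      D.extremeCoeff m =
        (-1) ^ (D.circleCount (LinkDiagram.extremeState X m) - 1) *
          (D.skeletonCurves m).indepProduct := by
  refine ⟨fun a => D.existsUnique_skeletonNext, fun b => D.existsUnique_skeletonPrev,
    fun a b => D.skeletonNext_sign, fun m => ⟨D.skeletonCurves_isotopic m,
      fun c hc q hqc hq => D.existsUnique_skeletonPt hq (hc q q hqc hqc hq hq).1, ?_, ?_⟩⟩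
  · ext c
    rw [D.mem_crossChords_stateCurves,
      D.mem_crossChords_skeletonCurves hplanar hnonsplit hreduced]
  · obtain ⟨κ, hopp, hrot⟩ := D.exists_checkerboard hplanar hnonsplit
    let K : D.Checkerboard := ⟨κ, hopp, hrot⟩
    rw [D.extremeCoeff_eq_sum hnonsplit.1 (K.circleCount_flipState_le m),
      LinkDiagram.sum_eq_indepProduct hplanar hnonsplit hreduced K]
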